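/- Let $n \ge 1$ be an integer, let $q = 3^n$, and let $b \in \mathbb{F}_q^\times$ satisfy $b^{(q-1)/2} = (-1)^{n+1}$ (that is, $b$ is a square in $\mathbb{F}_q^\times$ if $n$ is odd, and a non-square if $n$ is even). Put $k = \mathbb{F}_{q^2}$ and $K = k(t)$, and let $E = E_{n,b}$ be the elliptic curve over $K$ given by $y^2 = x^3 + bx + t^{q+1}$. For a place $v$ of $K$ with residue field $\mathbb{F}_v$ and degree $\deg v = [\mathbb{F}_v : k]$, let $\overline{E_v}$ be the reduction at $v$ of a minimal integral Weierstrass model of $E$ at $v$ (a possibly singular projective curve over $\mathbb{F}_v$), let $a_v(E) = |\mathbb{F}_v| + 1 - |\overline{E_v}(\mathbb{F}_v)|$, and set $$L_v(E/K,T) = \begin{cases} 1 - a_v(E)\,T^{\deg v} + |k|^{\deg v}\,T^{2\deg v} & \text{if $E$ has good reduction at $v$,}\\ 1 - a_v(E)\,T^{\deg v} & \text{otherwise.}\end{cases}$$ Then the $L$-function $L(E/K,T) = \prod_v L_v(E/K,T)^{-1} \in \mathbb{Z}[[T]]$, where $v$ runs over all places of $K$ (the product converges coefficientwise), is equal to the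 polynomial $$L(E_{n,b}/\mathbb{F}_{q^2}(t),\,T) = (1 - q^2 T)^{2\cdot 3^n}.$$ In particular the analytic rank of $E_{n,b}$ over $\mathbb{F}_{q^2}(t)$, i.e. the order of vanishing of $L(E/K,T)$ at $T = |k|^{-1} = q^{-2}$, is equal to $2\cdot 3^n$. -/

import Mathlib

open scoped PowerSeries.WithPiTopology

namespace FunctionField

/-- A place of the field `K` over the field of constants `k`, represented by its valuation ring:
a discrete valuation ring with fraction field `K` that contains the constants. -/
structure Place (k K : Type*) [Field k] [Field K] [Algebra k K] where
  /-- The valuation ring of the place. -/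
  ring : ValuationSubring K
  isDVR : IsDiscreteValuationRing ring
  algebraMap_mem : ∀ c : k, algebraMap k K c ∈ ring

namespace Place

variable {k K : Type*} [Field k] [Field K] [Algebra k K] (v : Place k K)

instance : IsDiscreteValuationRing v.ring := v.isDVR

noncomputable instance : Algebra k v.ring :=
  ((algebraMap k K).codRestrict v.ring.toSubring v.algebraMap_mem).toAlgebra

/-- The residue field `𝔽_v` of the place `v`. -/
abbrev ResField : Type _ := IsLocalRing.ResidueField v.ring

/-- The degree `[𝔽_v : k]` of the place `v`. -/
noncomputable def degree : ℕ := Module.finrank k v.ResField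

end Place

/-- The number of points over `F` of the projective plane curve (possibly singular) given by a
Weierstrass equation `W`: the affine solutions together with the one point at infinity
`[0 : 1 : 0]`. -/
noncomputable def numPoints {F : Type*} [Field F] (W : WeierstrassCurve F) : ℕ :=
  Nat.card {P : F × F // W.toAffine.Equation P.1 P.2} + 1

section LFunction

variable {k K : Type*} [Field k] [Field K] [Algebra k K] (E : WeierstrassCurve K)

/-- `a_v(E) = |𝔽_v| + 1 - |E_v(𝔽_v)|`, where `E_v` is the reduction of a minimal integral
Weierstrass model of `E` at `v`. -/
noncomputable def traceAt (v : Place k K) : ℤ :=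
  (Nat.card v.ResField : ℤ) + 1 - (numPoints ((E.minimal v.ring).reduction v.ring) : ℤ)

open scoped Classical in
open Polynomial in
/-- The local factor of `E` at `v`: `1 - a_v T ^ deg v + |k| ^ deg v T ^ (2 deg v)` if `E` has good
reduction at `v`, and `1 - a_v T ^ deg v` otherwise. -/
noncomputable def localFactor (v : Place k K) : ℤ[X] :=
  if (E.minimal v.ring).HasGoodReduction v.ring then
    1 - C (traceAt E v) * X ^ v.degree + C ((Nat.card k : ℤ) ^ v.degree) * X ^ (2 * v.degree)
  else 1 - C (traceAt E v) * X ^ v.degree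

/-- The inverse in `ℤ⟦T⟧` of the local factor of `E` at `v` (whose constant coefficient is `1`). -/
noncomputable def eulerFactor (v : Place k K) : PowerSeries ℤ :=
  PowerSeries.invOfUnit (localFactor E v : PowerSeries ℤ) 1

variable (k) in
/-- The `L`-function of `E` over `K`, with field of constants `k`: the product in `ℤ⟦T⟧` (for the
topology of coefficientwise convergence) of the inverses of all local factors. -/
noncomputable def LFunction : PowerSeries ℤ :=
  ∏' v : Place k K, eulerFactor E v

variable (k) in
/-- The `L`-function of `E` is a polynomial which vanishes to order exactly `r` at `T = |k|⁻¹`,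
i.e. the analytic rank of `E` over `K` is `r`. -/
def HasAnalyticRank (r : ℕ) : Prop :=
  ∃ P : Polynomial ℤ, P ≠ 0 ∧ (P : PowerSeries ℤ) = LFunction k E ∧
    (P.map (Int.castRingHom ℚ)).rootMultiplicity ((Nat.card k : ℚ)⁻¹) = r

end LFunction

/-- The Weierstrass curve `E_{n,b} : y² = x³ + b x + t ^ (3 ^ n + 1)` over `k(t)`. -/
noncomputable def curveE (k : Type*) [Field k] (n : ℕ) (b : k) : WeierstrassCurve (RatFunc k) where
  a₁ := 0
  a₂ := 0
  a₃ := 0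
  a₄ := RatFunc.C b
  a₆ := RatFunc.X ^ (3 ^ n + 1)

end FunctionField

/-! Let `L` be the extension of `k` of degree `m`, with `Q = q^(2m)` elements, and let `Λ` be the
image of the additive map `x ↦ x³ + βx` on `L`. Since `-β` is a square in `k`, the kernel has order
three and `Λ` has index three. The curve `y² = x³ + βx + c` then has `3 · #{y | y² - c ∈ Λ}` affine
points over `L`, so its trace depends only on whether `c ∈ Λ`: it is `2(-q)^m` or `-(-q)^m`
(`three_mul_card_filter_sq_mem`).

The hypothesis on `b` makes `s + s^q` lie in `Λ` for every `s` (`add_pow_mem_range`) and gives `y^q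
= -y` exactly `q` solutions. Modulo `Λ`, and after a shift of `y`, the expression `y² - t^(q+1)`
becomes affine in `t` for fixed `y`. This yields the exact number of pairs `(y, t)` with value in
`Λ` (`card_filter_sq_sub_pow_mem`), so the traces over all `t ∈ L` add up to `-2qQ`
(`AdmissibleCoeff.sum_trace`).

The discriminant is the constant `-β³`, so every place where `t` is integral is good; the remaining
place has cuspidal reduction and Euler factor `1`. Places of the first kind are conjugacy classes of
algebraic elements, so the coefficient of index `m` in `T L'/L` is the sum of traces over `t ∈ L`,
namely `-2q · q^(2m)`. These are the coefficients belonging to `(1 - q²T)^(2q)`, and a series with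
constant term `1` is determined by its logarithmic derivative (`IsLogDeriv.coeff_eq`). -/

namespace FunctionField

/-! ### Counting squares modulo a subgroup of index three. -/

section IndexThree

open Finset
open scoped Classical

variable {F : Type*} [Field F] [Fintype F] (Λ : AddSubgroup F)

theorem card_filter_mul_sub_mem {u : F} (hu : u ≠ 0) (c : F) :
    #{v | u * v - c ∈ Λ} = #{v | v ∈ Λ} := by
  refine card_bij' (fun v _ => u * v - c) (fun v _ => u⁻¹ * (v + c)) ?_ ?_ ?_ ?_
  · simp
  · intro v hv
    simpa [mul_inv_cancel_left₀ hu] using hv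
  · intro v _
    simp [inv_mul_cancel_left₀ hu]
  · intro v _
    simp [mul_inv_cancel_left₀ hu]

/-- The number of pairs with product in a subgroup of index three. -/
theorem card_filter_mul_mem :
    #{p : F × F | p.1 * p.2 ∈ Λ} + #{v | v ∈ Λ} = 
      Fintype.card F + Fintype.card F * #{v | v ∈ Λ} := by
  have h : #{p : F × F | p.1 * p.2 ∈ Λ} = ∑ u : F, #{v | u * v ∈ Λ} := by
    rw [← univ_product_univ, card_filter, sum_product]
    exact sum_congr rfl fun u _ => (card_filter _ _).symm
  rw [h, ← Finset.add_sum_erase _ _ (mem_univ (0 : F))]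
  have h2 : ∑ u ∈ univ.erase (0 : F), #{v | u * v ∈ Λ} =
      ∑ u ∈ univ.erase (0 : F), #{v | v ∈ Λ} := by
    refine sum_congr rfl fun u hu => ?_
    simpa using card_filter_mul_sub_mem Λ (ne_of_mem_erase hu) 0
  rw [h2, sum_const, card_erase_of_mem (mem_univ _), card_univ, smul_eq_mul]
  have hpos : 0 < Fintype.card F := Fintype.card_pos
  obtain ⟨N, hN⟩ := Nat.exists_eq_succ_of_ne_zero hpos.ne'
  simp only [zero_mul, Λ.zero_mem, filter_true, card_univ]
  rw [hN]
  simp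
  ring

/-- Sums over `F` split according to membership in `Λ`. -/
theorem sum_ite_mem_eq {ι : Type*} [Fintype ι] (P : ι → Prop) (f : ι → ℤ) {a b : ℤ}
    (ha : ∀ i, P i → f i = a) (hb : ∀ i, ¬ P i → f i = b) :
    ∑ i, f i = #{i | P i} * a + (Fintype.card ι - #{i | P i}) * b := by
  have h1 : ∑ i, f i = ∑ i, if P i then a else b :=
    sum_congr rfl fun i _ => by split_ifs with h <;> simp [ha, hb, h]
  rw [h1, sum_ite, sum_const, sum_const, nsmul_eq_mul, nsmul_eq_mul]
  have := card_filter_add_card_filter_not (s := (univ : Finset ι)) P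
  rw [← card_univ, ← this]
  push_cast
  ring

variable (h3 : 3 * #{v | v ∈ Λ} = Fintype.card F)
include h3

/-- The quotient `F ⧸ Λ` has prime order three, so the class of `c` generates it. -/
theorem mem_or_sub_mem_or_add_mem {c : F} (hc : c ∉ Λ) (s : F) :
    s ∈ Λ ∨ s - c ∈ Λ ∨ s + c ∈ Λ := by
  have hcard : Nat.card (F ⧸ Λ) = 3 := by
    have h := Λ.card_mul_index
    have h' : Nat.card Λ = #{v | v ∈ Λ} := by
      rw [Nat.card_eq_fintype_card, Fintype.card_subtype]
    rw [h', Nat.card_eq_fintype_card, ← h3, mul_comm 3] at h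
    have hpos : 0 < #{v | v ∈ Λ} := card_pos.mpr ⟨0, by simp⟩
    exact Nat.eq_of_mul_eq_mul_left hpos h
  have hc' : (c : F ⧸ Λ) ≠ 0 := by rwa [Ne, QuotientAddGroup.eq_zero_iff]
  have : Fact (Nat.Prime 3) := ⟨Nat.prime_three⟩
  have htop := zmultiples_eq_top_of_prime_card hcard hc'
  have hs : (s : F ⧸ Λ) ∈ AddSubgroup.zmultiples (c : F ⧸ Λ) := htop ▸ AddSubgroup.mem_top _
  obtain ⟨j, hj⟩ := AddSubgroup.mem_zmultiples_iff.mp hs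
  have h3c : (3 : ℤ) • (c : F ⧸ Λ) = 0 := by
    have := card_nsmul_eq_zero' (x := (c : F ⧸ Λ))
    rw [hcard] at this
    exact_mod_cast this
  have hmod : j • (c : F ⧸ Λ) = (j % 3) • (c : F ⧸ Λ) := by
    conv_lhs => rw [← Int.emod_add_mul_ediv j 3]
    rw [add_zsmul, mul_comm, mul_zsmul, h3c, zsmul_zero, add_zero]
  have hr : j % 3 = 0 ∨ j % 3 = 1 ∨ j % 3 = 2 := by omega
  rw [hmod] at hj
  rcases hr with h | h | h <;> rw [h] at hj
  · left
    rw [← QuotientAddGroup.eq_zero_iff, ← hj, zero_zsmul]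
  · right; left
    rw [← QuotientAddGroup.eq_zero_iff, QuotientAddGroup.mk_sub, ← hj, one_zsmul, sub_self]
  · right; right
    rw [← QuotientAddGroup.eq_zero_iff, QuotientAddGroup.mk_add, ← hj, ← h3c]
    abel

variable [CharP F 3]

/-- The number of `y` with `y²` in a given nontrivial coset of `Λ`, when `-1` is a square. -/
theorem two_mul_card_filter_sq_sub_mem {i : F} (hi : i ^ 2 = -1) {c : F} (hc : c ∉ Λ) :
    2 * (#{y : F | y ^ 2 - c ∈ Λ} : ℤ) = Fintype.card F - #{y : F | y ^ 2 ∈ Λ} := by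
  have hi0 : i ≠ 0 := by rintro rfl; simp at hi
  -- Multiplication by `i` negates `y²`, so the two nontrivial cosets are hit equally often.
  have h1 : #{y : F | y ^ 2 + c ∈ Λ} = #{y : F | y ^ 2 - c ∈ Λ} := by
    have key : ∀ y : F, (i * y) ^ 2 = - y ^ 2 := fun y => by rw [mul_pow, hi]; ring
    refine card_bij' (fun y _ => i * y) (fun y _ => - i * y) ?_ ?_ ?_ ?_
    · intro y hy
      simp only [mem_filter, mem_univ, true_and] at hy ⊢
      have := Λ.neg_mem hy
      rwa [show -(y ^ 2 + c) = (i * y) ^ 2 - c by rw [key]; ring] at this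
    · intro y hy
      simp only [mem_filter, mem_univ, true_and] at hy ⊢
      have := Λ.neg_mem hy
      rwa [show -(y ^ 2 - c) = (- i * y) ^ 2 + c by rw [neg_mul, neg_sq, key]; ring] at this
    · intro y _
      linear_combination -y * hi
    · intro y _
      linear_combination -y * hi
  have h3' : (3 : F) = 0 := by exact_mod_cast CharP.cast_eq_zero F 3
  have hd1 : Disjoint (univ.filter fun y : F => y ^ 2 ∈ Λ) (univ.filter fun y : F => y ^ 2 - c ∈ Λ) := by
    rw [disjoint_filter]
    intro y _ hy hy'
    exact hc (by simpa using Λ.sub_mem hy hy')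
  have hd2 : Disjoint ((univ.filter fun y : F => y ^ 2 ∈ Λ) ∪ univ.filter fun y : F => y ^ 2 - c ∈ Λ)
      (univ.filter fun y : F => y ^ 2 + c ∈ Λ) := by
    rw [disjoint_union_left, disjoint_filter, disjoint_filter]
    refine ⟨fun y _ hy hy' => hc (by simpa using Λ.sub_mem hy' hy), fun y _ hy hy' => hc ?_⟩
    have := Λ.sub_mem hy hy'
    rwa [show y ^ 2 - c - (y ^ 2 + c) = c by linear_combination -c * h3'] at this
  have hun : ((univ.filter fun y : F => y ^ 2 ∈ Λ) ∪ univ.filter fun y : F => y ^ 2 - c ∈ Λ) ∪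
      (univ.filter fun y : F => y ^ 2 + c ∈ Λ) = univ := by
    ext y
    have := mem_or_sub_mem_or_add_mem Λ h3 hc (y ^ 2)
    simp only [mem_union, mem_filter, mem_univ, true_and]
    tauto
  have h := congrArg card hun
  rw [card_union_of_disjoint hd2, card_union_of_disjoint hd1, h1, card_univ] at h
  omega

/-- The pairs with `u² + v² ∈ Λ` are counted twice: through the factorisation `(u + iv)(u - iv)`,
and by fixing `v` and using the distribution of squares among the cosets. Equating the counts gives
a quadratic equation, which leaves a sign undetermined. -/
theorem sq_three_mul_card_filter_sq_mem {i : F} (hi : i ^ 2 = -1) :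
    (3 * (#{y : F | y ^ 2 ∈ Λ} : ℤ) - Fintype.card F) ^ 2 = 4 * Fintype.card F := by
  have h3' : (3 : F) = 0 := by exact_mod_cast CharP.cast_eq_zero F 3
  have hi0 : i ≠ 0 := by rintro rfl; simp at hi
  have h1 : #{p : F × F | p.1 ^ 2 + p.2 ^ 2 ∈ Λ} = #{p : F × F | p.1 * p.2 ∈ Λ} := by
    -- The inverse uses `1/2 = -1` in characteristic three and `1/i = -i`.
    refine card_bij' (fun p _ => (p.1 + i * p.2, p.1 - i * p.2))
      (fun p _ => (-(p.1 + p.2), i * (p.1 - p.2))) ?_ ?_ ?_ ?_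
    · intro p hp
      simp only [mem_filter, mem_univ, true_and] at hp ⊢
      rwa [show (p.1 + i * p.2) * (p.1 - i * p.2) = p.1 ^ 2 + p.2 ^ 2 by
        linear_combination -p.2 ^ 2 * hi]
    · intro p hp
      simp only [mem_filter, mem_univ, true_and] at hp ⊢
      rwa [show (-(p.1 + p.2)) ^ 2 + (i * (p.1 - p.2)) ^ 2 = p.1 * p.2 by
        linear_combination (p.1 - p.2) ^ 2 * hi + p.1 * p.2 * h3']
    · intro p _
      ext
      · simp only
        linear_combination -p.1 * h3'
      · simp only
        linear_combination 2 * p.2 * hi - p.2 * h3'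
    · intro p _
      ext
      · simp only
        linear_combination (p.1 - p.2) * hi - p.1 * h3'
      · simp only
        linear_combination -(p.1 - p.2) * hi - p.2 * h3'
  have h2 : (#{p : F × F | p.1 ^ 2 + p.2 ^ 2 ∈ Λ} : ℤ) =
      ∑ z : F, (#{y : F | y ^ 2 + z ^ 2 ∈ Λ} : ℤ) := by
    rw [← univ_product_univ, card_filter, sum_product_right]
    push_cast
    exact sum_congr rfl fun u _ => by rw [card_filter]; push_cast; rfl
  have h4 : 2 * (#{p : F × F | p.1 ^ 2 + p.2 ^ 2 ∈ Λ} : ℤ) =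
      #{y : F | y ^ 2 ∈ Λ} * (2 * #{y : F | y ^ 2 ∈ Λ}) + 
      (Fintype.card F - #{y : F | y ^ 2 ∈ Λ}) * (Fintype.card F - #{y : F | y ^ 2 ∈ Λ}) := by
    rw [h2, mul_sum]
    refine sum_ite_mem_eq (fun z : F => z ^ 2 ∈ Λ) _ (fun z hz => ?_) (fun z hz => ?_)
    · simp only [Λ.add_mem_cancel_right hz]
    · have hz' : -z ^ 2 ∉ Λ := fun h => hz (by simpa using Λ.neg_mem h)
      simpa using two_mul_card_filter_sq_sub_mem Λ h3 hi hz'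
  have h5 := card_filter_mul_mem Λ
  rw [h1] at h4
  zify at h5 h3
  rw [← h3] at h5 h4 ⊢
  linear_combination -3 * h4 + 6 * h5

variable {q : ℕ} (hq : ∃ n, 1 ≤ n ∧ q = 3 ^ n) (hΛ : ∀ s, s + s ^ q ∈ Λ)
  (hneg : #{y : F | y ^ q = - y} = q)
include hq hΛ hneg

/-- The number of points on the surface `y² ≡ t ^ (q + 1)` modulo `Λ`. -/
theorem card_filter_sq_sub_pow_mem :
    3 * #{p : F × F | p.1 ^ 2 - p.2 ^ (q + 1) ∈ Λ} =
      Fintype.card F ^ 2 + 2 * q * Fintype.card F := by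
  obtain ⟨n, hn, rfl⟩ := hq
  have : Fact (Nat.Prime 3) := ⟨Nat.prime_three⟩
  have h3' : (3 : F) = 0 := by exact_mod_cast CharP.cast_eq_zero F 3
  have h1 : #{p : F × F | p.1 ^ 2 - p.2 ^ (3 ^ n + 1) ∈ Λ} =
      #{p : F × F | p.1 ^ 2 - p.1 * (p.2 - p.2 ^ 3 ^ n) ∈ Λ} := by
    -- With `Y = y - (t - t^q)` the expression is `Y² - Y(t - t^q)` up to `t² + t^(2q) ∈ Λ`; for
    -- fixed `Y` it is affine in `t` over the prime field.
    have key : ∀ y t : F, y ^ 2 - t ^ (3 ^ n + 1) =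
        ((y - (t - t ^ 3 ^ n)) ^ 2 - (y - (t - t ^ 3 ^ n)) * (t - t ^ 3 ^ n)) +
          (t ^ 2 + (t ^ 2) ^ 3 ^ n) := by
      intro y t
      rw [pow_right_comm t 2, pow_succ t (3 ^ n)]
      generalize t ^ 3 ^ n = T
      linear_combination (y * (t - T) - t ^ 2 - T ^ 2 + t * T) * h3'
    refine card_bij' (fun p _ => (p.1 - (p.2 - p.2 ^ 3 ^ n), p.2))
      (fun p _ => (p.1 + (p.2 - p.2 ^ 3 ^ n), p.2)) ?_ ?_ ?_ ?_
    · intro p hp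
      simp only [mem_filter, mem_univ, true_and] at hp ⊢
      rwa [key, Λ.add_mem_cancel_right (hΛ _)] at hp
    · intro p hp
      simp only [mem_filter, mem_univ, true_and] at hp ⊢
      rwa [key, Λ.add_mem_cancel_right (hΛ _), add_sub_cancel_right]
    · intro p _; simp
    · intro p _; simp
  have h2 : (#{p : F × F | p.1 ^ 2 - p.1 * (p.2 - p.2 ^ 3 ^ n) ∈ Λ} : ℤ) =
      ∑ y : F, (#{t : F | y ^ 2 - y * (t - t ^ 3 ^ n) ∈ Λ} : ℤ) := by
    rw [← univ_product_univ, card_filter, sum_product]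
    push_cast
    exact sum_congr rfl fun u _ => by rw [card_filter]; push_cast; rfl
  have h4 : ∑ y : F, (#{t : F | y ^ 2 - y * (t - t ^ 3 ^ n) ∈ Λ} : ℤ) =
      #{y : F | y ^ 3 ^ n = - y} * (Fintype.card F : ℤ) +
        (Fintype.card F - #{y : F | y ^ 3 ^ n = - y}) * #{v | v ∈ Λ} := by
    refine sum_ite_mem_eq (fun y : F => y ^ 3 ^ n = -y) _ (fun y hy => ?_) (fun y hy => ?_)
    · have hall : ∀ t : F, y ^ 2 - y * (t - t ^ 3 ^ n) ∈ Λ := by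
        intro t
        have ha := hΛ (y * t)
        have hb := hΛ (y ^ 2)
        have he : y ^ 2 - y * (t - t ^ 3 ^ n) =
            -(y ^ 2 + (y ^ 2) ^ 3 ^ n) - (y * t + (y * t) ^ 3 ^ n) := by
          rw [mul_pow, pow_right_comm, hy]
          linear_combination y ^ 2 * h3'
        rw [he]
        exact Λ.sub_mem (Λ.neg_mem hb) ha
      simp only [hall, filter_true, card_univ]
    -- With `w^q = y` one has `y t^q = (wt)^q ≡ -wt` modulo `Λ`, so the condition becomes `(w + y)t
    -- - y² ∈ Λ`. The coefficient `w + y` vanishes only when `y^q = -y`.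
    · obtain ⟨w, hw⟩ : ∃ w : F, w ^ 3 ^ n = y := by
        obtain ⟨w, hw⟩ := (Finite.injective_iff_bijective.mp
          (iterateFrobenius F 3 n).injective).2 y
        exact ⟨w, by simpa [iterateFrobenius_def] using hw⟩
      have hwy : w + y ≠ 0 := by
        intro h
        apply hy
        have h' : w = -y := eq_neg_of_add_eq_zero_left h
        rw [h', Odd.neg_pow (Odd.pow (by decide))] at hw
        rw [← hw, neg_neg, hw]
      have he : ∀ t : F, y ^ 2 - y * (t - t ^ 3 ^ n) ∈ Λ ↔ (w + y) * t - y ^ 2 ∈ Λ := by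
        intro t
        have ha := hΛ (w * t)
        rw [mul_pow, hw] at ha
        rw [← Λ.neg_mem_iff, ← Λ.add_mem_cancel_right ha]
        exact iff_of_eq (congrArg (· ∈ Λ) (by ring))
      simp only [he, card_filter_mul_sub_mem Λ hwy]
  rw [h1]
  zify at h3 ⊢
  rw [h2, h4, hneg, ← h3]
  push_cast
  ring

end IndexThree

end FunctionField

/-! ### Determining the sign by a divisibility argument. -/

namespace FunctionField

/-- A subset of a finite group stable under right multiplication by `g` has cardinality divisible by
the order of `g`. -/
theorem orderOf_dvd_card_of_mul_mem {G : Type*} [Group G] [Finite G] {g : G} {s : Set G}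
    (hs : ∀ x ∈ s, x * g ∈ s) : orderOf g ∣ Nat.card s := by
  have hpow : ∀ j : ℕ, ∀ x ∈ s, x * g ^ j ∈ s := by
    intro j
    induction j with
    | zero => intro x hx; simpa using hx
    | succ j ih => intro x hx; rw [pow_succ, ← mul_assoc]; exact hs _ (ih x hx)
  have h : s = (QuotientGroup.mk : G → G ⧸ Subgroup.zpowers g) ⁻¹'
      ((QuotientGroup.mk : G → G ⧸ Subgroup.zpowers g) '' s) := by
    refine Set.Subset.antisymm (Set.subset_preimage_image _ _) ?_
    rintro x ⟨y, hy, hxy⟩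
    rw [QuotientGroup.eq] at hxy
    obtain ⟨j, hj⟩ := mem_powers_iff_mem_zpowers.mpr hxy
    have : x = y * g ^ j := by simp only at hj; rw [hj]; group
    exact this ▸ hpow j y hy
  rw [h, QuotientGroup.card_preimage_mk, Nat.card_zpowers]
  exact dvd_mul_right _ _

section IndexThree

open Finset
open scoped Classical

variable {F : Type*} [Field F] [Fintype F] (Λ : AddSubgroup F)

/-- An element of `Fˣ` of order `2(q + 1)` has `(q + 1)`-th power `±1`, and `Λ = -Λ`, so
multiplication by it preserves the nonzero solutions. The extra `1` is `t = 0`. -/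
theorem two_mul_succ_dvd_card_filter_pow_mem {q : ℕ} (hq : 2 * (q + 1) ∣ Fintype.card F - 1) :
    ∃ w : ℕ, #{t : F | t ^ (q + 1) ∈ Λ} = 1 + 2 * (q + 1) * w := by
  obtain ⟨g, hg⟩ := IsCyclic.exists_ofOrder_eq_natCard (α := Fˣ)
  rw [Nat.card_eq_fintype_card, Fintype.card_units] at hg
  obtain ⟨e, he⟩ := hq
  have hF : 0 < Fintype.card F - 1 := Nat.sub_pos_of_lt Fintype.one_lt_card
  have he0 : e ≠ 0 := by rintro rfl; omega
  have hord : orderOf (g ^ e) = 2 * (q + 1) := by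
    rw [orderOf_pow_of_dvd he0 (by rw [hg, he]; exact dvd_mul_left _ _), hg, he,
      Nat.mul_div_cancel _ (Nat.pos_of_ne_zero he0)]
  have hsq : (((g ^ e) ^ (q + 1) : Fˣ) : F) = 1 ∨ (((g ^ e) ^ (q + 1) : Fˣ) : F) = -1 := by
    rw [← mul_self_eq_one_iff, ← Units.val_mul, ← pow_add, ← two_mul, ← hord, pow_orderOf_eq_one,
      Units.val_one]
  have hdvd := orderOf_dvd_card_of_mul_mem (g := g ^ e)
    (s := {x : Fˣ | (x : F) ^ (q + 1) ∈ Λ}) (by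
      intro x hx
      simp only [Set.mem_ofPred_eq, Units.val_mul, mul_pow] at hx ⊢
      rw [← Units.val_pow_eq_pow_val (g ^ e)]
      rcases hsq with h | h <;> rw [h]
      · simpa using hx
      · simpa using hx)
  rw [hord] at hdvd
  obtain ⟨w, hw⟩ := hdvd
  refine ⟨w, ?_⟩
  rw [← hw, Nat.card_eq_fintype_card, Fintype.card_subtype]
  have h0 : ({t : F | t ^ (q + 1) ∈ Λ} : Finset F) =
      insert 0 (({x : Fˣ | (x : F) ^ (q + 1) ∈ Λ} : Finset Fˣ).map ⟨Units.val, Units.val_injective⟩) := by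
    ext t
    simp only [mem_filter, mem_univ, true_and, mem_insert, mem_map, Function.Embedding.coeFn_mk]
    constructor
    · intro h
      rcases eq_or_ne t 0 with h0 | h0
      · exact Or.inl h0
      · exact Or.inr ⟨Units.mk0 t h0, h, rfl⟩
    · rintro (rfl | ⟨x, hx, rfl⟩)
      · simp
      · exact hx
  rw [h0, card_insert_of_notMem (by simp), card_map, add_comm]
  rfl

variable (h3 : 3 * #{v | v ∈ Λ} = Fintype.card F) [CharP F 3]
  {q : ℕ} (hq : ∃ n, 1 ≤ n ∧ q = 3 ^ n) (hΛ : ∀ s, s + s ^ q ∈ Λ)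
  (hneg : #{y : F | y ^ q = - y} = q) {m : ℕ} (hF : Fintype.card F = q ^ (2 * m))
  {i : F} (hi : i ^ 2 = -1)
include h3 hq hΛ hneg hF hi

/-- The quadratic relation leaves `3A = Q ± 2(-q)^m`. The sign is settled by computing the pair
count of `card_filter_sq_sub_pow_mem` again, fixing `t` instead of `y`. -/
theorem three_mul_card_filter_sq_mem :
    3 * (#{y : F | y ^ 2 ∈ Λ} : ℤ) = Fintype.card F - 2 * (-q) ^ m := by
  have hsq := sq_three_mul_card_filter_sq_mem Λ h3 hi
  have hN := card_filter_sq_sub_pow_mem Λ h3 hq hΛ hneg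
  have hq3 : 3 ≤ q ∧ Odd q := by
    obtain ⟨n, hn, rfl⟩ := hq
    exact ⟨by simpa using Nat.pow_le_pow_right (by norm_num : 0 < 3) hn, Odd.pow (by decide)⟩
  have hdvd1 : (2 * (q + 1) : ℤ) ∣ q ^ 2 - 1 := by
    obtain ⟨j, hj⟩ := hq3.2
    exact ⟨j, by rw [hj]; push_cast; ring⟩
  have hdvd2 : (2 * (q + 1) : ℤ) ∣ q ^ (2 * m) - 1 := by
    rw [pow_mul]
    exact hdvd1.trans (by simpa using sub_dvd_pow_sub_pow ((q : ℤ) ^ 2) 1 m)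
  obtain ⟨w, hw⟩ := two_mul_succ_dvd_card_filter_pow_mem (q := q) Λ (by
    have hpos : 1 ≤ Fintype.card F := Fintype.card_pos
    zify [hpos]
    rw [hF]
    exact_mod_cast hdvd2)
  have hsum : 2 * (#{p : F × F | p.1 ^ 2 - p.2 ^ (q + 1) ∈ Λ} : ℤ) =
      #{t : F | t ^ (q + 1) ∈ Λ} * (2 * #{y : F | y ^ 2 ∈ Λ}) +
      (Fintype.card F - #{t : F | t ^ (q + 1) ∈ Λ}) *
        (Fintype.card F - #{y : F | y ^ 2 ∈ Λ}) := by
    have h2 : (#{p : F × F | p.1 ^ 2 - p.2 ^ (q + 1) ∈ Λ} : ℤ) =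
        ∑ t : F, (#{y : F | y ^ 2 - t ^ (q + 1) ∈ Λ} : ℤ) := by
      rw [← univ_product_univ, card_filter, sum_product_right]
      push_cast
      exact sum_congr rfl fun u _ => by rw [card_filter]; push_cast; rfl
    rw [h2, mul_sum]
    refine sum_ite_mem_eq (fun t : F => t ^ (q + 1) ∈ Λ) _ (fun t ht => ?_) (fun t ht => ?_)
    · simp only [sub_eq_add_neg, Λ.add_mem_cancel_right (Λ.neg_mem ht)]
    · exact two_mul_card_filter_sq_sub_mem Λ h3 hi ht
  rw [hw] at hsum
  zify at hN
  have hQ : (Fintype.card F : ℤ) = ((-q) ^ m) ^ 2 := by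
    rw [hF]; push_cast; rw [← pow_mul, mul_comm m 2, pow_mul, pow_mul, neg_sq]
  rw [hF] at hQ
  push_cast at hQ
  rw [hF] at hsq hN hsum ⊢
  push_cast at hsq hN hsum ⊢
  generalize (#{y : F | y ^ 2 ∈ Λ} : ℤ) = A at *
  generalize (#{p : F × F | p.1 ^ 2 - p.2 ^ (q + 1) ∈ Λ} : ℤ) = N at *
  have hR : (-q : ℤ) ^ m ≠ 0 := pow_ne_zero _ (by have := hq3.1; omega)
  have hdvd3 : ((q : ℤ) + 1) ∣ (-q) ^ (m + 1) - 1 := by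
    have := sub_dvd_pow_sub_pow (-q : ℤ) 1 (m + 1)
    rw [one_pow] at this
    rw [← dvd_neg, ← neg_dvd] at this
    rw [← dvd_neg]
    convert! this using 1
    ring
  rw [pow_succ] at hdvd3
  generalize (-q : ℤ) ^ m = R at *
  rw [hQ] at hsq hsum hN hdvd2 ⊢
  have hcase : (3 * A - R ^ 2 - 2 * R) * (3 * A - R ^ 2 + 2 * R) = 0 := by
    linear_combination hsq
  rcases mul_eq_zero.mp hcase with h | h
  -- Put `R = (-q)^m`. The wrong sign forces `3B = R² + 2qR`, where `B` counts the `t` with `t^(q+1)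
  -- ∈ Λ`. Modulo `2(q + 1)` one has `B ≡ 1`, `R² ≡ 1` and `2qR ≡ -2`, so `2(q + 1)` would divide
  -- `4`.
  · exfalso
    have h1 : 2 * R * (2 * q * R + R ^ 2 - 3 * (1 + 2 * (q + 1) * w)) = 0 := by
      linear_combination 3 * hsum - 2 * hN + (3 * (1 + 2 * (q + 1) * w) - R ^ 2) * h
    have h2 : 2 * q * R + R ^ 2 - 3 * (1 + 2 * (q + 1) * w) = 0 := by
      simpa [hR] using h1
    obtain ⟨u, hu⟩ := hdvd2
    obtain ⟨v, hv⟩ := hdvd3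
    have h4 : (2 * ((q : ℤ) + 1)) ∣ 4 := ⟨u - v - 3 * w, by linear_combination -h2 + hu - 2 * hv⟩
    have := Int.le_of_dvd (by norm_num) h4
    have := hq3.1
    omega
  · linear_combination h

theorem three_mul_card_filter_sq_sub_mem (c : F) :
    3 * (#{y : F | y ^ 2 - c ∈ Λ} : ℤ) =
      Fintype.card F - (-q) ^ m * if c ∈ Λ then 2 else -1 := by
  have h := three_mul_card_filter_sq_mem Λ h3 hq hΛ hneg hF hi
  split_ifs with hc
  · simp only [sub_eq_add_neg _ c, Λ.add_mem_cancel_right (Λ.neg_mem hc), h]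
    ring
  · have h' := two_mul_card_filter_sq_sub_mem Λ h3 hi hc
    linarith

end IndexThree

end FunctionField

/-! ### The map `x³ + βx` on extensions of `k`, and sums of traces. -/

namespace FunctionField

theorem neg_one_pow_three_pow_half {R : Type*} [Monoid R] [HasDistribNeg R] (n : ℕ) :
    (-1 : R) ^ ((3 ^ n - 1) / 2) = (-1) ^ n := by
  induction n with
  | zero => simp
  | succ n ih =>
    have hodd : Odd (3 ^ n) := Odd.pow (by decide)
    obtain ⟨j, hj⟩ := hodd
    have h : (3 ^ (n + 1) - 1) / 2 = 3 * ((3 ^ n - 1) / 2) + 1 := by rw [pow_succ]; omega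
    rw [h, pow_succ, pow_mul, pow_succ]
    simp [pow_succ, ih]

/-- The additive endomorphism `x ↦ x ^ 3 + β x` of a ring of characteristic three. -/
noncomputable def cubicHom {L : Type*} [CommRing L] [CharP L 3] (β : L) : L →+ L :=
  (frobenius L 3).toAddMonoidHom + AddMonoidHom.mulLeft β

@[simp]
theorem cubicHom_apply {L : Type*} [CommRing L] [CharP L 3] (β x : L) :
    cubicHom β x = x ^ 3 + β * x := by
  simp [cubicHom, frobenius_def]

/-- The image of `x ↦ x ^ 3 + β x`. -/
noncomputable def cubicImage {L : Type*} [CommRing L] [CharP L 3] (β : L) : AddSubgroup L :=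
  (cubicHom β).range

theorem mem_cubicImage {L : Type*} [CommRing L] [CharP L 3] {β c : L} :
    c ∈ cubicImage β ↔ ∃ x, cubicHom β x = c := Iff.rfl

theorem cubicHom_mem {L : Type*} [CommRing L] [CharP L 3] (β x : L) :
    cubicHom β x ∈ cubicImage β := ⟨x, rfl⟩

section CubicHom

open Finset
open scoped Classical

variable {L : Type*} [Field L] [Fintype L] [CharP L 3] {β ρ : L}

theorem card_filter_cubicHom_eq_zero (hρ : ρ ^ 2 = -β) (hρ0 : ρ ≠ 0) :
    #{x : L | cubicHom β x = 0} = 3 := by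
  have h3' : (3 : L) = 0 := by exact_mod_cast CharP.cast_eq_zero L 3
  have h : ({x : L | cubicHom β x = 0} : Finset L) = {0, ρ, -ρ} := by
    ext x
    simp only [mem_filter, mem_univ, true_and, cubicHom_apply, mem_insert, mem_singleton]
    have hf : x ^ 3 + β * x = x * ((x - ρ) * (x + ρ)) := by linear_combination x * hρ
    rw [hf, mul_eq_zero, mul_eq_zero, sub_eq_zero, add_eq_zero_iff_eq_neg]
  have h1 : ρ ≠ -ρ := by
    intro h1
    apply hρ0
    linear_combination -h1 + ρ * h3'
  rw [h, card_insert_of_notMem, card_insert_of_notMem, card_singleton]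
  · simpa using h1
  · simpa [eq_comm] using hρ0

theorem card_filter_cubicHom_eq (hρ : ρ ^ 2 = -β) (hρ0 : ρ ≠ 0) (c : L) :
    #{x : L | cubicHom β x = c} = if c ∈ cubicImage β then 3 else 0 := by
  split_ifs with h
  · rw [← card_filter_cubicHom_eq_zero hρ hρ0]
    exact AddMonoidHom.card_fiber_eq_of_mem_range (cubicHom β) h ⟨0, map_zero _⟩
  · rw [card_eq_zero, filter_eq_empty_iff]
    exact fun x _ hx => h (mem_cubicImage.mpr ⟨x, hx⟩)

theorem three_mul_card_cubicHom_range (hρ : ρ ^ 2 = -β) (hρ0 : ρ ≠ 0) :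
    3 * #{v | v ∈ cubicImage β} = Fintype.card L := by
  rw [← card_univ, card_eq_sum_card_fiberwise (f := cubicHom β) (s := (univ : Finset L)) (t := univ) (by simp)]
  have hc : ∀ c ∈ (univ : Finset L), #{x ∈ (univ : Finset L) | cubicHom β x = c} =
      if c ∈ cubicImage β then 3 else 0 := fun c _ => by
    convert! card_filter_cubicHom_eq hρ hρ0 c
  rw [sum_congr rfl hc, ← sum_filter, sum_const, smul_eq_mul, mul_comm]

/-- The number of affine points of `y² = x³ + β x + c` in terms of the image of `x³ + β x`. -/
theorem card_cubic_points (hρ : ρ ^ 2 = -β) (hρ0 : ρ ≠ 0) (c : L) :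
    #{P : L × L | P.2 ^ 2 = P.1 ^ 3 + β * P.1 + c} =
      3 * #{y : L | y ^ 2 - c ∈ cubicImage β} := by
  have h : #{P : L × L | P.2 ^ 2 = P.1 ^ 3 + β * P.1 + c} =
      ∑ y : L, #{x : L | cubicHom β x = y ^ 2 - c} := by
    rw [← univ_product_univ, card_filter, sum_product_right]
    refine sum_congr rfl fun y _ => ?_
    rw [card_filter]
    refine sum_congr rfl fun x _ => if_congr ?_ rfl rfl
    rw [cubicHom_apply, eq_sub_iff_add_eq, eq_comm]
  rw [h]
  simp only [card_filter_cubicHom_eq hρ hρ0]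
  rw [← sum_filter, sum_const, smul_eq_mul, mul_comm]

end CubicHom

/-- The hypotheses on the coefficient `β` of the curve and on the finite field `k`. -/
structure AdmissibleCoeff {k : Type*} [Field k] (n : ℕ) (β : k) : Prop where
  one_le : 1 ≤ n
  card_eq : Nat.card k = (3 ^ n) ^ 2
  ne_zero : β ≠ 0
  pow_half : β ^ ((3 ^ n - 1) / 2) = (-1) ^ (n + 1)
  -- This bound records that `k` contains the field of `3^n` elements.
  le_card_fixed : 3 ^ n ≤ Nat.card {u : k // u ^ 3 ^ n = u}

namespace AdmissibleCoeff

open Finset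
open scoped Classical

variable {k : Type*} [Field k] {n : ℕ} {β : k} (h : AdmissibleCoeff n β)
include h

protected theorem finite : Finite k :=
  Nat.finite_of_card_ne_zero (by rw [h.card_eq]; positivity)

protected theorem charP : CharP k 3 := by
  have := h.finite
  have := Fintype.ofFinite k
  have : Fact (Nat.Prime 3) := ⟨Nat.prime_three⟩
  exact charP_of_card_eq_prime_pow (f := n * 2) (by rw [← Nat.card_eq_fintype_card, h.card_eq, pow_mul])

theorem half_card : Nat.card k / 2 = (3 ^ n - 1) / 2 * (3 ^ n + 1) := by
  obtain ⟨j, hj⟩ : Odd (3 ^ n) := Odd.pow (by decide)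
  have h1 : (3 ^ n - 1) / 2 = j := by omega
  have h2 : (3 ^ n) ^ 2 = 2 * (j * (3 ^ n + 1)) + 1 := by rw [hj]; ring
  rw [h.card_eq, h1]
  omega

/-- Euler's criterion: the exponent `(q² - 1)/2` is `(q - 1)/2` times the even number `q + 1`. -/
theorem isSquare_of_pow_half {a : k} (ha0 : a ≠ 0)
    (ha : a ^ ((3 ^ n - 1) / 2) = 1 ∨ a ^ ((3 ^ n - 1) / 2) = -1) : IsSquare a := by
  have := h.charP
  have := h.finite
  have := Fintype.ofFinite k
  rw [FiniteField.isSquare_iff (by rw [ringChar.eq k 3]; decide) ha0, ← Nat.card_eq_fintype_card,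
    h.half_card, pow_mul]
  have heven : Even (3 ^ n + 1) := Odd.add_one (Odd.pow (by decide))
  rcases ha with ha | ha <;> rw [ha]
  · exact one_pow _
  · exact heven.neg_one_pow

theorem exists_sq_eq_neg_one : ∃ i : k, i ^ 2 = -1 := by
  obtain ⟨i, hi⟩ := h.isSquare_of_pow_half (a := -1) (by simp) (by
    rw [neg_one_pow_three_pow_half]; exact neg_one_pow_eq_or k n)
  exact ⟨i, by rw [hi, sq]⟩

/-- Since `(q - 1)/2` has the parity of `n`, the sign imposed on `β` gives `(-β)^((q-1)/2) = -1`. A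
square root `ρ` of `-β` therefore satisfies `ρ^(q-1) = -1`. -/
theorem exists_sq_eq_neg : ∃ ρ : k, ρ ^ 2 = -β ∧ ρ ≠ 0 ∧ ρ ^ 3 ^ n = -ρ := by
  have hn : (-β) ^ ((3 ^ n - 1) / 2) = -1 := by
    rw [neg_pow, neg_one_pow_three_pow_half, h.pow_half, ← pow_add]
    exact Odd.neg_one_pow ⟨n, by ring⟩
  obtain ⟨ρ, hρ⟩ := h.isSquare_of_pow_half (neg_ne_zero.mpr h.ne_zero) (Or.inr hn)
  rw [← sq] at hρ
  refine ⟨ρ, hρ.symm, ?_, ?_⟩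
  · rintro rfl
    exact h.ne_zero (by simpa using hρ)
  · obtain ⟨j, hj⟩ : Odd (3 ^ n) := Odd.pow (by decide)
    have h1 : (3 ^ n - 1) / 2 = j := by omega
    rw [hj, pow_succ, pow_mul, ← hρ, ← h1, hn, neg_one_mul]

variable (L : Type*) [Field L] [Algebra k L]

/-- The degree of `X^q + X` bounds the count above; the multiples of `ρ` by solutions of `u^q = u`
bound it below. -/
theorem card_filter_pow_eq_neg [Fintype L] : #{y : L | y ^ 3 ^ n = - y} = 3 ^ n := by
  obtain ⟨ρ, -, hρ0, hρ⟩ := h.exists_sq_eq_neg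
  have h3n : 1 < 3 ^ n := Nat.one_lt_pow (by have := h.one_le; omega) (by norm_num)
  apply le_antisymm
  · let P : Polynomial L := Polynomial.X ^ 3 ^ n + Polynomial.X
    have hdeg : P.natDegree = 3 ^ n := by
      rw [Polynomial.natDegree_add_eq_left_of_natDegree_lt]
      · simp
      · simpa using h3n
    have hP : P ≠ 0 := by
      intro h0
      rw [h0] at hdeg
      simp at hdeg
      omega
    calc _ ≤ P.roots.toFinset.card := by
          refine card_le_card fun y hy => ?_
          simp only [mem_filter, mem_univ, true_and] at hy
          simp [P, hP, hy]
      _ ≤ P.roots.card := P.roots.toFinset_card_le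
      _ ≤ 3 ^ n := hdeg ▸ P.card_roots'
  · refine h.le_card_fixed.trans ?_
    rw [← Fintype.card_subtype, ← Nat.card_eq_fintype_card]
    refine Nat.card_le_card_of_injective (fun u => ⟨algebraMap k L (ρ * u.1), ?_⟩) ?_
    · rw [← map_pow, mul_pow, hρ, u.2, neg_mul, map_neg]
    · intro u v huv
      simpa [hρ0, Subtype.ext_iff] using huv

theorem card_extension [Fintype L] {m : ℕ} (hm : Module.finrank k L = m) :
    Fintype.card L = (3 ^ n) ^ (2 * m) := by
  have := h.finite
  rw [← Nat.card_eq_fintype_card, Module.natCard_eq_pow_finrank (K := k), hm, h.card_eq, pow_mul]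

variable [CharP L 3]

/-- The image of `b⁻¹z` under `x³ + bx` is `b⁻³z³ + z`, so `z ≡ -b⁻³z³` modulo the image. After `n`
iterations from `s` the coefficient of `s^q` is `(-1)^n (b^(-(q-1)/2))³ = -1` by the hypothesis on
`b`. -/
theorem add_pow_mem_range (s : L) :
    s + s ^ 3 ^ n ∈ cubicImage (algebraMap k L β) := by
  set b := algebraMap k L β with hb
  have hb0 : b ≠ 0 := by simpa [hb] using h.ne_zero
  have key : ∀ j : ℕ, s - (-1) ^ j * (b⁻¹) ^ (3 * ((3 ^ j - 1) / 2)) * s ^ 3 ^ j ∈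
      cubicImage b := by
    intro j
    induction j with
    | zero => simp
    | succ j ih =>
      have hodd : Odd (3 ^ j) := Odd.pow (by decide)
      obtain ⟨i, hi⟩ := hodd
      have he : (3 ^ (j + 1) - 1) / 2 = 3 * ((3 ^ j - 1) / 2) + 1 := by rw [pow_succ]; omega
      rw [he]
      generalize (3 ^ j - 1) / 2 = e at ih ⊢
      have h2 := (cubicImage b).add_mem ih
        (cubicHom_mem b (b⁻¹ * ((-1) ^ j * (b⁻¹) ^ (3 * e) * s ^ 3 ^ j)))
      have hneg : ((-1 : L) ^ j) ^ 3 = (-1) ^ j := by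
        rcases neg_one_pow_eq_or L j with h | h <;> rw [h] <;> norm_num
      rw [cubicHom_apply, mul_inv_cancel_left₀ hb0] at h2
      convert! h2 using 1
      rw [mul_pow, mul_pow, mul_pow, hneg, ← pow_mul s, ← pow_succ]
      ring
  have hn := key n
  have hpow : (b⁻¹) ^ ((3 ^ n - 1) / 2) = (-1) ^ (n + 1) := by
    rw [inv_pow, hb, ← map_pow, h.pow_half]
    rw [map_pow, map_neg, map_one, ← inv_pow, inv_neg_one]
  rw [mul_comm 3, pow_mul, hpow, ← pow_mul, ← pow_add,
    Odd.neg_one_pow ⟨2 * n + 1, by ring⟩, neg_one_mul, sub_neg_eq_add] at hn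
  exact hn

/-- Two applications of `s^q ≡ -s` give `s^(q²) ≡ s`, which is then iterated. -/
theorem pow_sub_mem_range (s : L) (j : ℕ) :
    s ^ (3 ^ n) ^ (2 * j) - s ∈ cubicImage (algebraMap k L β) := by
  induction j with
  | zero => simp
  | succ j ih =>
    have hs : ∀ i, s ^ (3 ^ n) ^ (i + 1) = (s ^ (3 ^ n) ^ i) ^ 3 ^ n := fun i => by
      rw [pow_succ, pow_mul]
    have h1 := h.add_pow_mem_range L (s ^ (3 ^ n) ^ (2 * j))
    have h2 := h.add_pow_mem_range L (s ^ (3 ^ n) ^ (2 * j + 1))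
    rw [← hs] at h1 h2
    have h3 := AddSubgroup.add_mem _ (AddSubgroup.sub_mem _ h2 h1) ih
    convert! h3 using 1
    rw [show 2 * (j + 1) = 2 * j + 1 + 1 by ring]
    ring

variable [Fintype L] {m : ℕ} (hm : Module.finrank k L = m)
include hm

/-- The point count for `y² = x³ + β x + c` over a finite extension of `k` of degree `m`. -/
theorem card_cubic_points (c : L) :
    (#{P : L × L | P.2 ^ 2 = P.1 ^ 3 + algebraMap k L β * P.1 + c} : ℤ) =
      Fintype.card L -
        (-3 ^ n) ^ m * if c ∈ cubicImage (algebraMap k L β) then 2 else -1 := by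
  obtain ⟨ρ, hρ, hρ0, -⟩ := h.exists_sq_eq_neg
  obtain ⟨i, hi⟩ := h.exists_sq_eq_neg_one
  have hρ' : (algebraMap k L ρ) ^ 2 = - algebraMap k L β := by rw [← map_pow, hρ, map_neg]
  have hρ0' : algebraMap k L ρ ≠ 0 := by simpa using hρ0
  have hi' : (algebraMap k L i) ^ 2 = -1 := by rw [← map_pow, hi, map_neg, map_one]
  have hA := three_mul_card_filter_sq_sub_mem _
    (three_mul_card_cubicHom_range hρ' hρ0') ⟨n, h.one_le, rfl⟩ (h.add_pow_mem_range L)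
    (h.card_filter_pow_eq_neg L) (h.card_extension L hm) hi' c
  rw [FunctionField.card_cubic_points hρ' hρ0', Nat.cast_mul, Nat.cast_ofNat, hA, Nat.cast_pow,
    Nat.cast_ofNat]

/-- Each summand is `Q - 3 · #{y | y² - t^(q+1) ∈ Λ}`, so the sum is `Q²` minus three times the pair
count of `card_filter_sq_sub_pow_mem`. -/
theorem sum_trace : ∑ t : L, ((-3 ^ n) ^ m *
      if t ^ (3 ^ n + 1) ∈ cubicImage (algebraMap k L β) then 2 else -1 : ℤ) =
    - (2 * 3 ^ n * (3 ^ n) ^ (2 * m)) := by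
  obtain ⟨ρ, hρ, hρ0, -⟩ := h.exists_sq_eq_neg
  obtain ⟨i, hi⟩ := h.exists_sq_eq_neg_one
  have hρ' : (algebraMap k L ρ) ^ 2 = - algebraMap k L β := by rw [← map_pow, hρ, map_neg]
  have hρ0' : algebraMap k L ρ ≠ 0 := by simpa using hρ0
  have hi' : (algebraMap k L i) ^ 2 = -1 := by rw [← map_pow, hi, map_neg, map_one]
  have hN := card_filter_sq_sub_pow_mem (q := 3 ^ n) _
    (three_mul_card_cubicHom_range hρ' hρ0') ⟨n, h.one_le, rfl⟩ (h.add_pow_mem_range L)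
    (h.card_filter_pow_eq_neg L)
  have h1 : ∀ t : L, ((-3 ^ n) ^ m *
      if t ^ (3 ^ n + 1) ∈ cubicImage (algebraMap k L β) then 2 else -1 : ℤ) =
      Fintype.card L -
        3 * #{y : L | y ^ 2 - t ^ (3 ^ n + 1) ∈ cubicImage (algebraMap k L β)} := by
    intro t
    have hA := three_mul_card_filter_sq_sub_mem _
      (three_mul_card_cubicHom_range hρ' hρ0') ⟨n, h.one_le, rfl⟩ (h.add_pow_mem_range L)
      (h.card_filter_pow_eq_neg L) (h.card_extension L hm) hi' (t ^ (3 ^ n + 1))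
    rw [hA, Nat.cast_pow, Nat.cast_ofNat, sub_sub_cancel]
  have h2 : (#{p : L × L | p.1 ^ 2 - p.2 ^ (3 ^ n + 1) ∈
      cubicImage (algebraMap k L β)} : ℤ) =
      ∑ t : L, (#{y : L | y ^ 2 - t ^ (3 ^ n + 1) ∈
        cubicImage (algebraMap k L β)} : ℤ) := by
    rw [← univ_product_univ, card_filter, sum_product_right]
    push_cast
    exact sum_congr rfl fun u _ => by rw [card_filter]; push_cast; rfl
  simp only [h1]
  rw [sum_sub_distrib, sum_const, ← mul_sum, ← h2, card_univ, nsmul_eq_mul]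
  zify at hN
  rw [hN, h.card_extension L hm]
  push_cast
  ring

end AdmissibleCoeff

/-- Membership in the image of `x³ + β x` for an extension of finite fields of degree `r`. -/
theorem AdmissibleCoeff.algebraMap_mem_range_iff {k : Type*} [Field k] {n : ℕ} {β : k}
    (h : AdmissibleCoeff n β) (L M : Type*) [Field L] [Field M] [Algebra k L] [Algebra k M]
    [CharP L 3] [CharP M 3] [Algebra L M] [IsScalarTower k L M] [Finite M] (c : L) :
    algebraMap L M c ∈ cubicImage (algebraMap k M β) ↔
      c ∈ cubicImage (algebraMap k L β) ∨ 3 ∣ Module.finrank L M := by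
  have : Finite L := Finite.of_injective _ (algebraMap L M).injective
  have := h.finite
  have := Fintype.ofFinite L
  have := Fintype.ofFinite M
  have h3L : (3 : L) = 0 := by exact_mod_cast CharP.cast_eq_zero L 3
  have h3M : (3 : M) = 0 := by exact_mod_cast CharP.cast_eq_zero M 3
  have : Fact (Nat.Prime 3) := ⟨Nat.prime_three⟩
  have hQ := h.card_extension L rfl
  rw [← Nat.card_eq_fintype_card] at hQ
  have hmap : ∀ x : L, algebraMap L M (cubicHom (algebraMap k L β) x) =
      cubicHom (algebraMap k M β) (algebraMap L M x) := by
    intro x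
    simp [← IsScalarTower.algebraMap_apply]
  constructor
  · intro hx
    obtain ⟨x, hx⟩ := mem_cubicImage.mp hx
    by_cases hr : 3 ∣ Module.finrank L M
    · exact Or.inr hr
    left
    -- The trace commutes with `x³ + βx`, as `β` comes from `k`. Hence `r c` is in the image over
    -- `L`, where `r = [M : L]`; when `3 ∤ r`, this is `±c`.
    have htr : cubicHom (algebraMap k L β) (Algebra.trace L M x) = Module.finrank L M • c := by
      apply (algebraMap L M).injective
      rw [hmap, FiniteField.algebraMap_trace_eq_sum_pow, map_sum, map_nsmul]
      have hterm : ∀ i : ℕ, cubicHom (algebraMap k M β) (x ^ Nat.card L ^ i) =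
          algebraMap L M c := by
        intro i
        have hfix : ∀ a : L, a ^ Nat.card L ^ i = a := fun a => by
          rw [Nat.card_eq_fintype_card, FiniteField.pow_card_pow]
        have hpow : cubicHom (algebraMap k M β) (x ^ Nat.card L ^ i) =
            (cubicHom (algebraMap k M β) x) ^ Nat.card L ^ i := by
          have hβ : (algebraMap k M β) ^ Nat.card L ^ i = algebraMap k M β := by
            rw [IsScalarTower.algebraMap_apply k L M, ← map_pow, hfix]
          rw [cubicHom_apply, cubicHom_apply]
          conv_lhs => rw [← hβ]
          have hQ' : Nat.card L ^ i = 3 ^ (n * (2 * Module.finrank k L) * i) := by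
            rw [hQ, ← pow_mul, ← pow_mul]
            simp only [mul_assoc]
          rw [hQ', add_pow_char_pow, mul_pow]
          ring
        rw [hpow, hx, ← map_pow, hfix]
      rw [Finset.sum_congr rfl fun i _ => hterm i, Finset.sum_const, Finset.card_range]
    have h1 : Module.finrank L M % 3 = 1 ∨ Module.finrank L M % 3 = 2 := by omega
    have h2 : Module.finrank L M • c = (Module.finrank L M % 3) • c := by
      conv_lhs => rw [← Nat.div_add_mod (Module.finrank L M) 3, nsmul_eq_mul]
      rw [nsmul_eq_mul]
      push_cast
      rw [h3L]
      ring
    rw [h2] at htr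
    rcases h1 with h1 | h1 <;> rw [h1] at htr
    · exact mem_cubicImage.mpr ⟨_, by rw [htr, one_smul]⟩
    · refine mem_cubicImage.mpr ⟨- Algebra.trace L M x, ?_⟩
      rw [map_neg, htr, two_smul]
      linear_combination -c * h3L
  · rintro (hx | hr)
    · obtain ⟨x, rfl⟩ := mem_cubicImage.mp hx
      exact mem_cubicImage.mpr ⟨algebraMap L M x, (hmap x).symm⟩
    -- Write `c` as the trace of `z`. When `3 ∣ r`, subtracting `r z = 0` turns the trace into a sum
    -- of differences `z^(|L|^i) - z`, each in the image.
    · obtain ⟨z, hz⟩ := Algebra.trace_surjective L M c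
      rw [← hz, FiniteField.algebraMap_trace_eq_sum_pow]
      have hterm : ∑ i ∈ Finset.range (Module.finrank L M), z ^ (Nat.card L ^ i) =
          ∑ i ∈ Finset.range (Module.finrank L M), (z ^ (Nat.card L ^ i) - z) := by
        obtain ⟨r, hr⟩ := hr
        rw [Finset.sum_sub_distrib, Finset.sum_const, Finset.card_range, hr, nsmul_eq_mul]
        push_cast
        rw [h3M]
        ring
      rw [hterm]
      refine AddSubgroup.sum_mem _ fun i _ => ?_
      rw [hQ, ← pow_mul, mul_assoc]
      exact h.pow_sub_mem_range M z _

end FunctionField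

/-! ### Logarithmic derivatives of integral power series. -/

namespace FunctionField

section LogDeriv

open PowerSeries

/-- `g` is the logarithmic derivative `X f' / f` of the power series `f`. -/
def IsLogDeriv (f g : ℤ⟦X⟧) : Prop :=
  X * d⁄dX ℤ f = f * g

namespace IsLogDeriv

theorem one : IsLogDeriv 1 0 := by
  rw [IsLogDeriv, derivative_one, mul_zero, mul_zero]

theorem mul {f₁ f₂ g₁ g₂ : ℤ⟦X⟧} (h₁ : IsLogDeriv f₁ g₁) (h₂ : IsLogDeriv f₂ g₂) :
    IsLogDeriv (f₁ * f₂) (g₁ + g₂) := by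
  rw [IsLogDeriv] at *
  rw [Derivation.leibniz, smul_eq_mul, smul_eq_mul]
  linear_combination f₂ * h₁ + f₁ * h₂

theorem prod {ι : Type*} {f g : ι → ℤ⟦X⟧} (s : Finset ι) (h : ∀ i ∈ s, IsLogDeriv (f i) (g i)) :
    IsLogDeriv (∏ i ∈ s, f i) (∑ i ∈ s, g i) := by
  classical
  induction s using Finset.induction_on with
  | empty => simpa using one
  | insert i s hi ih =>
    rw [Finset.prod_insert hi, Finset.sum_insert hi]
    exact (h i (Finset.mem_insert_self i s)).mul
      (ih fun j hj => h j (Finset.mem_insert_of_mem hj))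

theorem of_mul {f₁ f₂ g₁ g₂ : ℤ⟦X⟧} (h : IsLogDeriv (f₁ * f₂) (g₁ + g₂))
    (h₂ : IsLogDeriv f₂ g₂) (h0 : f₂ ≠ 0) : IsLogDeriv f₁ g₁ := by
  rw [IsLogDeriv] at *
  rw [Derivation.leibniz, smul_eq_mul, smul_eq_mul] at h
  refine mul_left_cancel₀ h0 ?_
  linear_combination h - f₁ * h₂

/-- The relation reads `j f_j = ∑ f_a g_b` over `a + b = j`. As `g_0 = 0`, only earlier coefficients
of `f` occur on the right, and `j` can be cancelled in `ℤ`. -/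
theorem coeff_eq {f₁ f₂ g₁ g₂ : ℤ⟦X⟧} (h₁ : IsLogDeriv f₁ g₁) (h₂ : IsLogDeriv f₂ g₂)
    (hf₁ : constantCoeff f₁ = 1) (hf₂ : constantCoeff f₂ = 1) (N : ℕ)
    (hg : ∀ j, j ≠ 0 → j ≤ N → coeff j g₁ = coeff j g₂) : coeff N f₁ = coeff N f₂ := by
  have h0 : ∀ {f g : ℤ⟦X⟧}, IsLogDeriv f g → constantCoeff f = 1 → coeff 0 g = 0 := by
    intro f g h hf
    have := congrArg constantCoeff h
    rw [map_mul, map_mul, constantCoeff_X, zero_mul, hf, one_mul] at this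
    rw [coeff_zero_eq_constantCoeff_apply, this]
  have hrec : ∀ {f g : ℤ⟦X⟧}, IsLogDeriv f g → ∀ j : ℕ, (j : ℤ) * coeff j f =
      ∑ p ∈ Finset.HasAntidiagonal.antidiagonal j, coeff p.1 f * coeff p.2 g := by
    intro f g h j
    rw [← coeff_mul, ← h]
    cases j with
    | zero => simp
    | succ j => rw [coeff_succ_X_mul, coeff_derivative]; push_cast; ring
  induction N using Nat.strong_induction_on with
  | _ N ih =>
    rcases eq_or_ne N 0 with rfl | hN
    · simp [hf₁, hf₂]
    have key : (N : ℤ) * coeff N f₁ = N * coeff N f₂ := by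
      rw [hrec h₁, hrec h₂]
      refine Finset.sum_congr rfl fun p hp => ?_
      have hp' := Finset.HasAntidiagonal.mem_antidiagonal.mp hp
      rcases eq_or_ne p.2 0 with h | h
      · rw [h, h0 h₁ hf₁, h0 h₂ hf₂, mul_zero, mul_zero]
      · rw [hg p.2 h (by omega), ih p.1 (by omega) fun j hj hj' => hg j hj (by omega)]
    exact mul_left_cancel₀ (by exact_mod_cast hN) key

end IsLogDeriv

/-- The geometric series `∑ c ^ j X ^ j` over the multiples `j` of `d`. -/
noncomputable def geomSeries (d : ℕ) (c : ℤ) : ℤ⟦X⟧ :=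
  mk fun j => if d ∣ j then c ^ j else 0

theorem one_sub_mul_geomSeries {d : ℕ} (hd : d ≠ 0) (c : ℤ) :
    (1 - C (c ^ d) * X ^ d) * geomSeries d c = 1 := by
  ext j
  rw [sub_mul, one_mul, map_sub, mul_assoc, coeff_C_mul, coeff_X_pow_mul', coeff_one, geomSeries,
    coeff_mk]
  rcases lt_or_ge j d with hj | hj
  · rw [if_neg (not_le.mpr hj)]
    rcases eq_or_ne j 0 with rfl | hj0
    · simp
    · rw [if_neg (Nat.not_dvd_of_pos_of_lt (Nat.pos_of_ne_zero hj0) hj), if_neg hj0]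
      simp
  · rw [if_pos hj, coeff_mk, if_neg (show j ≠ 0 by omega)]
    have hiff : d ∣ j - d ↔ d ∣ j := (Nat.dvd_sub_iff_left hj dvd_rfl)
    simp only [hiff]
    split_ifs with h
    · rw [← pow_add, Nat.add_sub_cancel' hj, sub_self]
    · simp

theorem isLogDeriv_one_sub {d : ℕ} (hd : d ≠ 0) (c : ℤ) :
    IsLogDeriv (1 - C (c ^ d) * X ^ d) (d * (1 - geomSeries d c)) := by
  have h := one_sub_mul_geomSeries hd c
  have hX : (X : ℤ⟦X⟧) * d⁄dX ℤ ((X : ℤ⟦X⟧) ^ d) = d * (X : ℤ⟦X⟧) ^ d := by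
    obtain ⟨e, rfl⟩ := Nat.exists_eq_succ_of_ne_zero hd
    rw [derivative_pow, derivative_X]
    simp only [Nat.succ_eq_add_one, Nat.add_sub_cancel]
    ring
  have hD : d⁄dX ℤ ((1 : ℤ⟦X⟧) - C (c ^ d) * X ^ d) = - (C (c ^ d) * d⁄dX ℤ ((X : ℤ⟦X⟧) ^ d)) := by
    rw [map_sub, derivative_one, Derivation.leibniz, derivative_C, smul_zero, add_zero, zero_sub,
      smul_eq_mul]
  rw [IsLogDeriv, hD]
  linear_combination -C (c ^ d) * hX + (d : ℤ⟦X⟧) * h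

theorem one_sub_C_mul_X_pow_ne_zero {d : ℕ} (hd : d ≠ 0) (c : ℤ) :
    (1 - C (c ^ d) * X ^ d : ℤ⟦X⟧) ≠ 0 :=
  left_ne_zero_of_mul_eq_one (one_sub_mul_geomSeries hd c)

theorem coeff_geomSeries (d : ℕ) (c : ℤ) (j : ℕ) :
    coeff j (geomSeries d c) = if d ∣ j then c ^ j else 0 :=
  coeff_mk _ _

/-- The logarithmic derivative of the inverse of `(1 - U) ^ 2` or of `1 + U + U ^ 2`, where
`U = (c X) ^ d`. -/
theorem exists_isLogDeriv_of_mul_eq_one {d : ℕ} (hd : d ≠ 0) (c : ℤ) (P : Prop) [Decidable P]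
    {e : ℤ⟦X⟧} (he : (1 - C (c ^ d * if P then 2 else -1) * X ^ d + C ((c ^ d) ^ 2) * X ^ (2 * d)) *
      e = 1) :
    ∃ g : ℤ⟦X⟧, IsLogDeriv e g ∧ ∀ j, j ≠ 0 → coeff j g =
      if d ∣ j then d * (c ^ j * if P ∨ 3 ∣ j / d then 2 else -1) else 0 := by
  have h1 := isLogDeriv_one_sub hd c
  have hne := one_sub_C_mul_X_pow_ne_zero hd c
  have hdN : ∀ (N j : ℕ), coeff j ((N : ℤ⟦X⟧) * (1 - geomSeries N c)) =
      N * ((if j = 0 then 1 else 0) - if N ∣ j then c ^ j else 0) := by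
    intro N j
    rw [← map_natCast (C (R := ℤ)), coeff_C_mul, map_sub, coeff_one, coeff_geomSeries]
  rw [map_mul C, map_pow C (c ^ d) 2, pow_mul' X] at he
  split_ifs at he with hP <;> simp only [map_ofNat, map_neg, map_one] at he
  · refine ⟨-(d * (1 - geomSeries d c) + d * (1 - geomSeries d c)), ?_, ?_⟩
    · refine IsLogDeriv.of_mul (f₂ := (1 - C (c ^ d) * X ^ d) * (1 - C (c ^ d) * X ^ d)) ?_
        (h1.mul h1) (mul_ne_zero hne hne)
      rw [neg_add_cancel]
      convert! IsLogDeriv.one using 1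
      linear_combination he
    · intro j hj
      rw [map_neg, map_add, hdN]
      simp only [hj, hP, true_or, if_true, if_false]
      split_ifs <;> ring
  -- Here `1 + U + U² = (1 - U³)/(1 - U)`; the numerator contributes the extra `3` that turns `-1`
  -- into `2` when `3 ∣ j / d`.
  · have h3 := isLogDeriv_one_sub (mul_ne_zero three_ne_zero hd) c
    refine ⟨d * (1 - geomSeries d c) - (3 * d : ℕ) * (1 - geomSeries (3 * d) c), ?_, ?_⟩
    · refine IsLogDeriv.of_mul (f₂ := 1 - C (c ^ (3 * d)) * X ^ (3 * d)) ?_ h3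
        (one_sub_C_mul_X_pow_ne_zero (mul_ne_zero three_ne_zero hd) c)
      rw [sub_add_cancel]
      convert! h1 using 1
      rw [pow_mul' c, pow_mul' X, map_pow C (c ^ d) 3]
      linear_combination (1 - C (c ^ d) * X ^ d) * he
    · intro j hj
      rw [map_sub, hdN, hdN]
      simp only [hj, hP, false_or, if_false]
      by_cases hdj : d ∣ j
      · have h3d : 3 * d ∣ j ↔ 3 ∣ j / d := by
          obtain ⟨r, rfl⟩ := hdj
          rw [mul_comm 3 d, Nat.mul_div_cancel_left _ (Nat.pos_of_ne_zero hd)]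
          exact Nat.mul_dvd_mul_iff_left (Nat.pos_of_ne_zero hd)
        simp only [hdj, h3d, if_true]
        split_ifs <;> push_cast <;> ring
      · have h3d : ¬ 3 * d ∣ j := fun h => hdj ((dvd_mul_left d 3).trans h)
        simp [hdj, h3d]

theorem isLogDeriv_one_sub_pow (a : ℤ) (N : ℕ) :
    ∃ g : ℤ⟦X⟧, IsLogDeriv ((1 - C a * X) ^ N) g ∧ ∀ j, j ≠ 0 → coeff j g = -(N * a ^ j) := by
  have h := isLogDeriv_one_sub one_ne_zero a
  have hN := IsLogDeriv.prod (Finset.range N) (fun _ _ => h)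
  simp only [pow_one, Finset.prod_const, Finset.card_range, Finset.sum_const] at hN
  refine ⟨_, hN, fun j hj => ?_⟩
  rw [map_nsmul, Nat.cast_one, one_mul, map_sub, coeff_one, if_neg hj, coeff_geomSeries,
    if_pos (one_dvd j), nsmul_eq_mul]
  ring

end LogDeriv

end FunctionField

/-! ### Places of `k(t)` at which `t` is integral. -/

namespace FunctionField

open Polynomial IsLocalRing

namespace Place

section General

variable {k K : Type*} [Field k] [Field K] [Algebra k K] (v : Place k K)

theorem ext_ring {v w : Place k K} (h : ∀ x, x ∈ v.ring ↔ x ∈ w.ring) : v = w := by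
  cases v
  cases w
  congr
  exact ValuationSubring.ext _ _ h

instance : IsScalarTower k v.ring K :=
  .of_algebraMap_eq fun _ => rfl

theorem exists_notMem : ∃ x, x ∉ v.ring := by
  by_contra! h
  refine IsDiscreteValuationRing.not_isField v.ring ?_
  refine ⟨⟨0, 1, zero_ne_one⟩, mul_comm, fun {a} ha => ?_⟩
  refine ⟨⟨(a : K)⁻¹, h _⟩, Subtype.ext ?_⟩
  exact mul_inv_cancel₀ (by simpa using ha)

theorem mem_of_pow_mem {x : K} {N : ℕ} (hN : N ≠ 0) (hx : x ^ N ∈ v.ring) : x ∈ v.ring := by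
  rw [← ValuationSubring.valuation_le_one_iff] at hx ⊢
  rw [map_pow] at hx
  exact (pow_le_one_iff hN).mp hx

instance isTrivialOn_valuation : v.ring.valuation.IsTrivialOn k where
  eq_one a ha := by
    have h1 : v.ring.valuation (algebraMap k K a) ≤ 1 :=
      (ValuationSubring.valuation_le_one_iff _ _).mpr (v.algebraMap_mem a)
    have h2 : v.ring.valuation (algebraMap k K a⁻¹) ≤ 1 :=
      (ValuationSubring.valuation_le_one_iff _ _).mpr (v.algebraMap_mem a⁻¹)
    rw [map_inv₀, map_inv₀] at h2
    refine le_antisymm h1 ?_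
    have h0 : v.ring.valuation (algebraMap k K a) ≠ 0 := by simpa using ha
    exact (inv_le_one₀ (zero_lt_iff.mpr h0)).mp h2

end General

section RatFunc

theorem mul_algebraMap_denom {k : Type*} [Field k] (x : RatFunc k) :
    x * algebraMap k[X] (RatFunc k) x.denom = algebraMap k[X] (RatFunc k) x.num := by
  conv_lhs => enter [1]; rw [← RatFunc.num_div_denom x]
  exact div_mul_cancel₀ _ (RatFunc.algebraMap_ne_zero (RatFunc.denom_ne_zero x))

open IsDedekindDomain in
theorem isLocalization_valuationSubringAtPrime {R K : Type*} [CommRing R] [IsDedekindDomain R]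
    [Field K] [Algebra R K] [IsFractionRing R K] (P : HeightOneSpectrum R) :
    IsLocalization P.asIdeal.primeCompl (P.valuationSubringAtPrime K) :=
  inferInstance

variable {k : Type*} [Field k] {v w : Place k (RatFunc k)}
  (hv : RatFunc.X ∈ v.ring) (hw : RatFunc.X ∈ w.ring)

/-- The image of the variable in the residue field of a place at which it is integral. -/
noncomputable def residueX : v.ResField :=
  residue v.ring ⟨RatFunc.X, hv⟩

theorem coe_aeval (p : k[X]) :
    ((aeval (⟨RatFunc.X, hv⟩ : v.ring) p : v.ring) : RatFunc k) =
      algebraMap k[X] (RatFunc k) p := by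
  rw [← RatFunc.aeval_X_left_eq_algebraMap]
  exact (aeval_algebraMap_apply (RatFunc k) (⟨RatFunc.X, hv⟩ : v.ring) p).symm

theorem residue_aeval (p : k[X]) :
    residue v.ring (aeval (⟨RatFunc.X, hv⟩ : v.ring) p) = aeval (residueX hv) p :=
  (aeval_algebraMap_apply v.ResField (⟨RatFunc.X, hv⟩ : v.ring) p).symm

theorem aeval_residueX_denom_ne_zero {x : RatFunc k} (hx : x ∈ v.ring) :
    aeval (residueX hv) x.denom ≠ 0 := by
  intro h0
  have hmul : (⟨x, hx⟩ : v.ring) * aeval (⟨RatFunc.X, hv⟩ : v.ring) x.denom =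
      aeval (⟨RatFunc.X, hv⟩ : v.ring) x.num := by
    apply Subtype.ext
    rw [MulMemClass.coe_mul, coe_aeval, coe_aeval]
    exact mul_algebraMap_denom x
  have hnum : aeval (residueX hv) x.num = 0 := by
    rw [← residue_aeval, ← hmul, map_mul, residue_aeval, h0, mul_zero]
  obtain ⟨a, b, hab⟩ := RatFunc.isCoprime_num_denom x
  have := congrArg (aeval (residueX hv)) hab
  simp [hnum, h0] at this

/-- Numerator and denominator are coprime, so they cannot both vanish at the residue of `X`.
Consequently the residue of `X`, up to conjugacy, determines the place. -/
theorem mem_ring_iff (x : RatFunc k) : x ∈ v.ring ↔ aeval (residueX hv) x.denom ≠ 0 := by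
  refine ⟨aeval_residueX_denom_ne_zero hv, fun h => ?_⟩
  rw [← residue_aeval, residue_ne_zero_iff_isUnit] at h
  obtain ⟨u, hu⟩ := h
  have hmul : algebraMap k[X] (RatFunc k) x.denom * (↑u⁻¹ : v.ring) = 1 := by
    rw [← coe_aeval hv, ← hu, ← MulMemClass.coe_mul, Units.mul_inv, OneMemClass.coe_one]
  have hx : x = ((aeval (⟨RatFunc.X, hv⟩ : v.ring) x.num * ↑u⁻¹ : v.ring) : RatFunc k) := by
    rw [MulMemClass.coe_mul, coe_aeval]
    conv_lhs => rw [← RatFunc.num_div_denom x]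
    rw [div_eq_iff (RatFunc.algebraMap_ne_zero (RatFunc.denom_ne_zero x)), mul_assoc, mul_comm _ (algebraMap _ _ _), hmul,
      mul_one]
  rw [hx]
  exact Subtype.mem _

theorem exists_aeval_mul_eq (y : v.ResField) : ∃ p s : k[X],
    aeval (residueX hv) s ≠ 0 ∧ y * aeval (residueX hv) s = aeval (residueX hv) p := by
  obtain ⟨⟨x, hx⟩, rfl⟩ := residue_surjective y
  refine ⟨x.num, x.denom, aeval_residueX_denom_ne_zero hv hx, ?_⟩
  rw [← residue_aeval, ← residue_aeval, ← map_mul]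
  congr 1
  apply Subtype.ext
  rw [MulMemClass.coe_mul, coe_aeval, coe_aeval]
  exact mul_algebraMap_denom x

variable {L : Type*} [Field L] [Algebra k L]

theorem algHom_ext {φ ψ : v.ResField →ₐ[k] L} (h : φ (residueX hv) = ψ (residueX hv)) : φ = ψ := by
  ext y
  obtain ⟨p, s, hs, hy⟩ := exists_aeval_mul_eq hv y
  have h1 : φ y * φ (aeval (residueX hv) s) = ψ y * ψ (aeval (residueX hv) s) := by
    rw [← map_mul, ← map_mul, hy, ← aeval_algHom_apply, ← aeval_algHom_apply, h]
  rw [← aeval_algHom_apply, ← aeval_algHom_apply, h] at h1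
  refine mul_right_cancel₀ ?_ h1
  rw [aeval_algHom_apply]
  simpa using hs

theorem eq_of_algHom {φ : v.ResField →ₐ[k] L} {ψ : w.ResField →ₐ[k] L}
    (h : φ (residueX hv) = ψ (residueX hw)) : v = w := by
  refine ext_ring fun x => ?_
  rw [mem_ring_iff hv, mem_ring_iff hw, ← map_ne_zero φ, ← map_ne_zero ψ, ← aeval_algHom_apply,
    ← aeval_algHom_apply, h]

include hv in
-- If the residue of `X` were transcendental, no denominator would vanish there and the valuation
-- ring would be all of `k(t)`.
theorem finite_resField : Module.Finite k v.ResField := by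
  have hint : IsIntegral k (residueX hv) := by
    rw [← isAlgebraic_iff_isIntegral]
    by_contra htr
    obtain ⟨x, hx⟩ := v.exists_notMem
    rw [mem_ring_iff hv, not_not] at hx
    exact htr ⟨x.denom, RatFunc.denom_ne_zero x, hx⟩
  have htop : IntermediateField.adjoin k {residueX hv} = ⊤ := by
    rw [eq_top_iff]
    intro y _
    obtain ⟨p, s, hs, hy⟩ := exists_aeval_mul_eq hv y
    have hmem : ∀ p : k[X], aeval (residueX hv) p ∈ IntermediateField.adjoin k {residueX hv} :=
      fun p => by
        have := IntermediateField.algebra_adjoin_le_adjoin k {residueX hv}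
        exact this (aeval_mem_adjoin_singleton k _)
    rw [eq_div_iff hs |>.mpr hy]
    exact div_mem (hmem p) (hmem s)
  have := IntermediateField.adjoin.finiteDimensional hint
  rw [htop] at this
  exact Module.Finite.equiv IntermediateField.topEquiv.toLinearEquiv

include hv in
theorem degree_ne_zero : v.degree ≠ 0 := by
  have := finite_resField hv
  exact Module.finrank_pos.ne'

/-- The place of `k(t)` at which `t` reduces to a given algebraic element of a field extension,
with its evaluation homomorphism. -/
theorem exists_ringHom_X_eq {θ : L} (hθ : IsIntegral k θ) :
    ∃ (v : Place k (RatFunc k)) (hv : RatFunc.X ∈ v.ring) (f : v.ring →+* L), IsLocalHom f ∧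
      (∀ c : k, f (algebraMap k v.ring c) = algebraMap k L c) ∧ f ⟨RatFunc.X, hv⟩ = θ := by
  have hD : IsDedekindDomain k[X] := IsPrincipalIdealRing.isDedekindDomain k[X]
  let P : IsDedekindDomain.HeightOneSpectrum k[X] :=
    { asIdeal := RingHom.ker (aeval θ)
      isPrime := RingHom.ker_isPrime _
      ne_bot := fun h => minpoly.ne_zero hθ ((Submodule.eq_bot_iff _).mp h _ (minpoly.aeval k θ)) }
  have hprime : P.asIdeal.IsPrime := P.isPrime
  have hP : ∀ p : k[X], p ∈ P.asIdeal ↔ aeval θ p = 0 := fun p => RingHom.mem_ker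
  let A := P.valuationSubringAtPrime (RatFunc k)
  have hloc : IsLocalization P.asIdeal.primeCompl A := isLocalization_valuationSubringAtPrime P
  have hcoe : ∀ p : k[X], ((algebraMap k[X] A p : A) : RatFunc k) = algebraMap k[X] (RatFunc k) p :=
    fun p => rfl
  have hunit : ∀ s : P.asIdeal.primeCompl, IsUnit ((aeval θ : k[X] →ₐ[k] L).toRingHom s) :=
    fun s => isUnit_iff_ne_zero.mpr fun h => s.2 ((hP _).mpr h)
  let f : A →+* L := IsLocalization.lift (M := P.asIdeal.primeCompl) hunit
  have hf : ∀ p, f (algebraMap k[X] A p) = aeval θ p := fun p => IsLocalization.lift_eq hunit p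
  have hlocal : IsLocalHom f := by
    refine ⟨fun a ha => ?_⟩
    obtain ⟨p, s, rfl⟩ := IsLocalization.exists_mk'_eq P.asIdeal.primeCompl a
    rw [IsLocalization.AtPrime.isUnit_mk'_iff A P.asIdeal]
    intro hp
    refine ha.ne_zero ((IsLocalization.lift_mk'_spec _ _ _ _).mpr ?_)
    rw [mul_zero]
    exact (hP p).mp hp
  have hX : (algebraMap k[X] A X : RatFunc k) = RatFunc.X := RatFunc.algebraMap_X
  exact ⟨{ ring := A
           isDVR := IsLocalization.AtPrime.isDiscreteValuationRing_of_dedekind_domain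
             k[X] P.ne_bot A
           algebraMap_mem := fun c => (algebraMap k[X] A (C c)).2 }, hX ▸ (algebraMap k[X] A X).2,
    f, hlocal, fun c => (hf (C c)).trans (aeval_C θ c),
    (congrArg f (Subtype.ext hX.symm)).trans ((hf X).trans (aeval_X θ))⟩

theorem exists_algHom_residueX_eq {θ : L} (hθ : IsIntegral k θ) :
    ∃ (v : Place k (RatFunc k)) (hv : RatFunc.X ∈ v.ring) (φ : v.ResField →ₐ[k] L),
      φ (residueX hv) = θ := by
  obtain ⟨v, hv, f, hf, hc, hX⟩ := exists_ringHom_X_eq hθ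
  exact ⟨v, hv, { ResidueField.lift f with commutes' := hc }, hX⟩

end RatFunc

end Place

end FunctionField

/-! ### Weierstrass models: point counts, minimality and integral changes of variables. -/

namespace FunctionField

open WeierstrassCurve

theorem numPoints_variableChange {F : Type*} [Field F] (C : VariableChange F)
    (W : WeierstrassCurve F) : numPoints (C • W) = numPoints W := by
  have hu : (C.u : F) ≠ 0 := C.u.ne_zero
  have key : ∀ x y : F, (C • W).toAffine.Equation x y ↔
      W.toAffine.Equation (C.u ^ 2 * x + C.r) (C.u ^ 3 * y + C.u ^ 2 * C.s * x + C.t) := by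
    intro x y
    rw [Affine.equation_iff, Affine.equation_iff, ← sub_eq_zero, ← sub_eq_zero (b := _ + W.a₆),
      ← mul_eq_zero_iff_left (pow_ne_zero 6 hu)]
    refine Eq.congr_left ?_
    simp only [variableChange_a₁, variableChange_a₂, variableChange_a₃, variableChange_a₄,
      variableChange_a₆, Units.val_inv_eq_inv_val]
    field_simp
    ring
  let e : F × F ≃ F × F :=
    { toFun := fun P => (C.u ^ 2 * P.1 + C.r, C.u ^ 3 * P.2 + C.u ^ 2 * C.s * P.1 + C.t)
      invFun := fun P => ((P.1 - C.r) / C.u ^ 2, (P.2 - C.s * (P.1 - C.r) - C.t) / C.u ^ 3)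
      left_inv := fun P => by
        ext
        · simp only; field_simp; ring
        · simp only; field_simp; ring
      right_inv := fun P => by
        ext
        · simp only; field_simp; ring
        · simp only; field_simp; ring }
  rw [numPoints, numPoints]
  exact congrArg (· + 1) (Nat.card_congr (e.subtypeEquiv fun P => key P.1 P.2))

/-- The number of points of a cuspidal Weierstrass curve over a finite field of characteristic
three. -/
theorem numPoints_of_b_eq_zero {F : Type*} [Field F] [Finite F] [CharP F 3]
    (W : WeierstrassCurve F) (h2 : W.b₂ = 0) (h4 : W.b₄ = 0) : numPoints W = Nat.card F + 1 := by
  have : Fact (Nat.Prime 3) := ⟨Nat.prime_three⟩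
  have h3 : (3 : F) = 0 := by exact_mod_cast CharP.cast_eq_zero F 3
  have hfrob := Finite.injective_iff_bijective.mp (frobenius F 3).injective
  choose g hg using hfrob.2
  simp only [frobenius_def] at hg
  -- In characteristic three the equation becomes `z² - b₆ = x³` with `z = a₁x + a₃ - y`. Cubing is
  -- bijective, so `z` parametrises the affine points.
  have key : ∀ x y : F, W.toAffine.Equation x y ↔
      (W.a₁ * x + W.a₃ - y) ^ 2 - W.b₆ = x ^ 3 := by
    intro x y
    rw [Affine.equation_iff]
    rw [b₂] at h2
    rw [b₄] at h4
    rw [b₆]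
    constructor <;> intro h
    · linear_combination h + x ^ 2 * h2 - x * h4 + (-W.a₁ * x * y - W.a₃ * y - x ^ 2 * W.a₂ + x * W.a₄  + x * W.a₁ * W.a₃ - W.a₆) * h3
    · linear_combination h - x ^ 2 * h2 + x * h4 - (-W.a₁ * x * y - W.a₃ * y - x ^ 2 * W.a₂ + x * W.a₄  + x * W.a₁ * W.a₃ - W.a₆) * h3
  unfold numPoints
  congr 1
  refine Nat.card_congr
    { toFun := fun P => W.a₁ * P.1.1 + W.a₃ - P.1.2
      invFun := fun z => ⟨(g (z ^ 2 - W.b₆), W.a₁ * g (z ^ 2 - W.b₆) + W.a₃ - z), ?_⟩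
      left_inv := ?_
      right_inv := ?_ }
  · rw [key, hg, sub_sub_cancel]
  · rintro ⟨⟨x, y⟩, h⟩
    have hx : g ((W.a₁ * x + W.a₃ - y) ^ 2 - W.b₆) = x := by
      apply (frobenius F 3).injective
      rw [frobenius_def, frobenius_def, hg, ← key]
      exact h
    ext
    · exact hx
    · simp only [hx, sub_sub_cancel]
  · intro z
    simp

section Minimal

variable (R : Type*) [CommRing R] [IsDomain R] [IsDiscreteValuationRing R]
  {K : Type*} [Field K] [Algebra R K] [IsFractionRing R K]

theorem exists_minimal_eq (W : WeierstrassCurve K) :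
    ∃ C : VariableChange K, W.minimal R = C • W :=
  ⟨_, rfl⟩

/-- A curve with an integral model of unit discriminant has good reduction. -/
theorem hasGoodReduction_minimal (W : WeierstrassCurve K) [IsIntegral R W] {u : R} (hu : IsUnit u)
    (hΔ : algebraMap R K u = W.Δ) : (W.minimal R).HasGoodReduction R := by
  obtain ⟨C, hC⟩ := exists_minimal_eq R W
  have hmin : IsMinimal R (W.minimal R) := inferInstance
  refine ⟨le_antisymm ?_ ?_⟩
  · obtain ⟨r, hr⟩ := Δ_integral_of_isIntegral R (W.minimal R)
    rw [← hr]
    exact IsDedekindDomain.HeightOneSpectrum.valuation_le_one _ _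
  · have hW : C⁻¹ • W.minimal R = W := by rw [hC, inv_smul_smul]
    have hmax := hmin.val_Δ_maximal.2 (j := C⁻¹) (by show WeierstrassCurve.IsIntegral R (C⁻¹ • _); rw [hW]; infer_instance)
    have hle : valuation_Δ_aux R (C⁻¹ • W.minimal R) ≤
        valuation_Δ_aux R ((1 : VariableChange K) • W.minimal R) :=
      (le_total _ _).elim hmax id
    rw [hW, one_smul] at hle
    have hle' : (valuation_Δ_aux R W : WithZero (Multiplicative ℤ)) ≤ valuation_Δ_aux R (W.minimal R) := hle
    rw [valuation_Δ_aux_eq_of_isIntegral, valuation_Δ_aux_eq_of_isIntegral, ← hΔ,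
      (IsDedekindDomain.HeightOneSpectrum.valuation_eq_one_iff_notMem
        (v := IsDiscreteValuationRing.maximalIdeal R)).mpr
        fun hmem => (IsLocalRing.mem_maximalIdeal u).mp hmem hu] at hle'
    exact hle'

end Minimal

section Curve

variable {k : Type*} [Field k] [CharP k 3] (n : ℕ) (β : k)

theorem three_eq_zero_ratFunc : (3 : RatFunc k) = 0 := by
  have : (3 : k) = 0 := by exact_mod_cast CharP.cast_eq_zero k 3
  rw [← map_ofNat (algebraMap k (RatFunc k)) 3, this, map_zero]

/-- In characteristic three the discriminant of `x³ + βx + c` does not involve `c`. -/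
theorem curveE_Δ : (curveE k n β).Δ = algebraMap k (RatFunc k) (-β ^ 3) := by
  have h3 := three_eq_zero_ratFunc (k := k)
  rw [map_neg, map_pow, RatFunc.algebraMap_eq_C]
  simp only [WeierstrassCurve.Δ, b₂, b₄, b₆, b₈, curveE]
  generalize (RatFunc.X : RatFunc k) ^ (3 ^ n + 1) = T
  linear_combination (-21 * (RatFunc.C β) ^ 3 - 144 * T ^ 2) * h3

theorem variableChange_curveE_b₂ (C : VariableChange (RatFunc k)) :
    (C • curveE k n β).b₂ = 0 := by
  have h3 := three_eq_zero_ratFunc (k := k)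
  rw [variableChange_b₂]
  simp only [b₂, curveE]
  linear_combination ((C.u⁻¹ : (RatFunc k)ˣ) : RatFunc k) ^ 2 * 4 * C.r * h3

variable (v : Place k (RatFunc k)) {β} (hβ : β ≠ 0)
include hβ

/-- The changes of variables between `E` and a minimal model with good reduction are integral. -/
theorem integral_of_hasGoodReduction {C : VariableChange (RatFunc k)}
    (hC : (curveE k n β).minimal v.ring = C • curveE k n β)
    (hgood : ((curveE k n β).minimal v.ring).HasGoodReduction v.ring) :
    (C.u : RatFunc k) ∈ v.ring ∧ ((C.u⁻¹ : (RatFunc k)ˣ) : RatFunc k) ∈ v.ring ∧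
      C.s ∈ v.ring ∧ C.t ∈ v.ring ∧
      C.r ^ 3 + RatFunc.C β * C.r + RatFunc.X ^ (3 ^ n + 1) ∈ v.ring := by
  have h3 := three_eq_zero_ratFunc (k := k)
  set W := (curveE k n β).minimal v.ring with hW
  rw [hasGoodReduction_iff_isElliptic_reduction, isElliptic_iff, isUnit_iff_ne_zero, reduction,
    map_Δ, IsLocalRing.residue_ne_zero_iff_isUnit] at hgood
  obtain ⟨w, hw⟩ := hgood
  -- The minimal discriminant is a unit and that of `E` is a nonzero constant, so `u^12` and
  -- `u^(-12)` are integral.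
  have hΔ : ((w : v.ring) : RatFunc k) = (C.u⁻¹ : (RatFunc k)ˣ) ^ 12 *
      algebraMap k (RatFunc k) (-β ^ 3) := by
    rw [hw, ← curveE_Δ n β, ← variableChange_Δ, ← hC]
    exact integralModel_Δ_eq v.ring W
  have hu0 : (C.u : RatFunc k) ≠ 0 := C.u.ne_zero
  have hβ' : algebraMap k (RatFunc k) (-β ^ 3) ≠ 0 := by simpa using hβ
  have hwinv : ((w : v.ring) : RatFunc k) * ((↑w⁻¹ : v.ring) : RatFunc k) = 1 := by
    rw [← MulMemClass.coe_mul, Units.mul_inv, OneMemClass.coe_one]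
  have hu : (C.u : RatFunc k) ∈ v.ring := by
    refine v.mem_of_pow_mem (N := 12) (by norm_num) ?_
    have : (C.u : RatFunc k) ^ 12 = algebraMap k (RatFunc k) (-β ^ 3) * ((↑w⁻¹ : v.ring) : RatFunc k) := by
      rw [hΔ, Units.val_inv_eq_inv_val] at hwinv
      field_simp at hwinv
      linear_combination -hwinv
    rw [this]
    exact mul_mem (v.algebraMap_mem _) (Subtype.mem _)
  have hui : ((C.u⁻¹ : (RatFunc k)ˣ) : RatFunc k) ∈ v.ring := by
    refine v.mem_of_pow_mem (N := 12) (by norm_num) ?_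
    have : ((C.u⁻¹ : (RatFunc k)ˣ) : RatFunc k) ^ 12 =
        ((w : v.ring) : RatFunc k) * algebraMap k (RatFunc k) (-β ^ 3)⁻¹ := by
      rw [hΔ, map_inv₀, mul_inv_cancel_right₀ hβ']
    rw [this]
    exact mul_mem (Subtype.mem _) (v.algebraMap_mem _)
  have hcoe : ∀ x : v.ring, (x : RatFunc k) ∈ v.ring := fun x => x.2
  have hui' : (C.u : RatFunc k) * ((C.u⁻¹ : (RatFunc k)ˣ) : RatFunc k) = 1 := C.u.mul_inv
  have ha₁ : W.a₁ ∈ v.ring := integralModel_a₁_eq v.ring W ▸ hcoe _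
  have ha₃ : W.a₃ ∈ v.ring := integralModel_a₃_eq v.ring W ▸ hcoe _
  have ha₆ : W.a₆ ∈ v.ring := integralModel_a₆_eq v.ring W ▸ hcoe _
  rw [hC, variableChange_a₁] at ha₁
  rw [hC, variableChange_a₃] at ha₃
  rw [hC, variableChange_a₆] at ha₆
  simp only [curveE] at ha₁ ha₃ ha₆
  have hs : C.s ∈ v.ring := by
    have := neg_mem (mul_mem hu ha₁)
    convert! this using 1
    linear_combination 2 * C.s * hui' + C.s * h3
  have ht : C.t ∈ v.ring := by
    have := neg_mem (mul_mem (pow_mem hu 3) ha₃)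
    convert! this using 1
    generalize ((C.u⁻¹ : (RatFunc k)ˣ) : RatFunc k) = i at *
    rw [mul_left_comm, ← mul_assoc, ← mul_pow, mul_comm i, hui']
    linear_combination C.t * h3
  -- The last claim comes from `a₆`: multiplied by `u⁶`, the new coefficient is `r³ + βr + X^(q+1) -
  -- t²`, with `t` the translation parameter.
  refine ⟨hu, hui, hs, ht, ?_⟩
  have := add_mem (mul_mem (pow_mem hu 6) ha₆) (pow_mem ht 2)
  convert! this using 1
  generalize ((C.u⁻¹ : (RatFunc k)ˣ) : RatFunc k) = i at *
  rw [← mul_assoc, ← mul_pow, hui']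
  ring

end Curve

end FunctionField

/-! ### Valuations and the local factors of `E`. -/

namespace FunctionField

open WeierstrassCurve

section Valuation

variable {k : Type*} [Field k] {v : Place k (RatFunc k)}

theorem Place.valuation_cubic (β : k) {x : RatFunc k} (hx : x ∉ v.ring) :
    v.ring.valuation (x ^ 3 + RatFunc.C β * x) = v.ring.valuation x ^ 3 := by
  rw [← ValuationSubring.valuation_le_one_iff, not_le] at hx
  rw [← map_pow]
  refine Valuation.map_add_eq_of_lt_left _ ?_
  have hβ : v.ring.valuation (RatFunc.C β) ≤ 1 :=
    (ValuationSubring.valuation_le_one_iff _ _).mpr (v.algebraMap_mem β)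
  rw [map_mul, map_pow]
  calc v.ring.valuation (RatFunc.C β) * v.ring.valuation x ≤ v.ring.valuation x ^ 1 := by
        rw [pow_one]; exact mul_le_of_le_one_left' hβ
    _ < _ := pow_lt_pow_right₀ hx (by norm_num)

theorem Place.mem_of_cubic_mem (β : k) {x : RatFunc k} (hx : x ^ 3 + RatFunc.C β * x ∈ v.ring) :
    x ∈ v.ring := by
  by_contra h
  rw [← ValuationSubring.valuation_le_one_iff, v.valuation_cubic β h] at hx
  rw [← ValuationSubring.valuation_le_one_iff] at h
  exact h ((pow_le_one_iff (by norm_num)).mp hx)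

section Infinite

variable (hv : RatFunc.X ∉ v.ring)
include hv

theorem Place.valuation_eq_of_X_notMem {x : RatFunc k} (hx : x ≠ 0) :
    v.ring.valuation x = v.ring.valuation RatFunc.X ^ x.intDegree := by
  rw [← ValuationSubring.valuation_le_one_iff, not_le] at hv
  exact RatFunc.valuation_eq_valuation_X_zpow_intDegree_of_one_lt_valuation_X hv hx

/-- For non-integral `x` the cubic part has a pole of order `3 deg x`, whereas `X^N` has order `N`
not divisible by three, so the two cannot cancel. For integral `x` only `X^N` has a pole. This
excludes good reduction at the infinite place. -/
theorem Place.cubic_add_X_pow_notMem (β : k) {N : ℕ} (hN : ¬ 3 ∣ N) (x : RatFunc k) :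
    x ^ 3 + RatFunc.C β * x + RatFunc.X ^ N ∉ v.ring := by
  have hN0 : N ≠ 0 := by rintro rfl; simp at hN
  have hXN : (RatFunc.X : RatFunc k) ^ N ∉ v.ring := fun h => hv (v.mem_of_pow_mem hN0 h)
  have hX := hv
  rw [← ValuationSubring.valuation_le_one_iff, not_le] at hX
  by_cases hx : x ∈ v.ring
  · intro h
    have hc : x ^ 3 + RatFunc.C β * x ∈ v.ring :=
      add_mem (pow_mem hx 3) (mul_mem (v.algebraMap_mem β) hx)
    exact hXN (by simpa using sub_mem h hc)
  · have hx0 : x ≠ 0 := by rintro rfl; exact hx (zero_mem _)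
    have hne : v.ring.valuation (x ^ 3 + RatFunc.C β * x) ≠
        v.ring.valuation (RatFunc.X ^ N) := by
      rw [v.valuation_cubic β hx, v.valuation_eq_of_X_notMem hv hx0, map_pow, ← zpow_natCast,
        ← zpow_natCast, ← zpow_mul]
      intro h
      have := (zpow_right_inj₀ (zero_lt_one.trans hX) hX.ne').mp h
      omega
    rw [← ValuationSubring.valuation_le_one_iff, not_le, Valuation.map_add_of_distinct_val _ hne]
    refine lt_max_of_lt_right ?_
    rw [map_pow]
    exact one_lt_pow₀ hX hN0

theorem Place.algebraMap_resField_surjective :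
    Function.Surjective (algebraMap k v.ResField) := by
  intro y
  obtain ⟨⟨x, hx⟩, rfl⟩ := IsLocalRing.residue_surjective y
  have hX := hv
  rw [← ValuationSubring.valuation_le_one_iff, not_le] at hX
  have hd0 := RatFunc.denom_ne_zero x
  have hdeg : x.num.natDegree ≤ x.denom.natDegree := by
    rcases eq_or_ne x 0 with rfl | hx0
    · simp
    rw [← ValuationSubring.valuation_le_one_iff, v.valuation_eq_of_X_notMem hv hx0] at hx
    by_contra! hlt
    refine hx.not_gt (one_lt_zpow₀ hX ?_)
    rw [RatFunc.intDegree]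
    omega
  -- The denominator is monic, so this coefficient is the value of `x` at infinity, and is zero when
  -- the numerator has smaller degree.
  set c := x.num.coeff x.denom.natDegree with hc
  refine ⟨c, ?_⟩
  rw [← sub_eq_zero]
  change IsLocalRing.residue v.ring (algebraMap k v.ring c) - IsLocalRing.residue v.ring ⟨x, hx⟩ = 0
  rw [← map_sub, IsLocalRing.residue_eq_zero_iff, ValuationSubring.valuation_lt_one_iff]
  set p := Polynomial.C c * x.denom - x.num with hp
  have hxp : ((algebraMap k v.ring c - ⟨x, hx⟩ : v.ring) : RatFunc k) =
      algebraMap _ (RatFunc k) p / algebraMap _ (RatFunc k) x.denom := by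
    rw [eq_div_iff (RatFunc.algebraMap_ne_zero hd0), hp, map_sub, map_mul,
      ← mul_algebraMap_denom x, ← sub_mul]
    rfl
  rw [hxp]
  by_cases hp0 : p = 0
  · rw [hp0, map_zero, zero_div, map_zero]
    exact zero_lt_one
  rw [v.valuation_eq_of_X_notMem hv (div_ne_zero (RatFunc.algebraMap_ne_zero hp0)
    (RatFunc.algebraMap_ne_zero hd0)), RatFunc.intDegree_div (RatFunc.algebraMap_ne_zero hp0)
    (RatFunc.algebraMap_ne_zero hd0), RatFunc.intDegree_polynomial, RatFunc.intDegree_polynomial]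
  refine zpow_lt_one_of_neg₀ hX ?_
  have hcoeff : p.coeff x.denom.natDegree = 0 := by
    rw [hp, Polynomial.coeff_sub, Polynomial.coeff_C_mul, (RatFunc.monic_denom x).coeff_natDegree,
      mul_one, sub_self]
  have hple : p.natDegree ≤ x.denom.natDegree :=
    (Polynomial.natDegree_sub_le_of_le (Polynomial.natDegree_C_mul_le _ _) hdeg).trans (by simp)
  have hlt : p.natDegree ≠ x.denom.natDegree := fun h => by
    rw [← h] at hcoeff
    exact hp0 (Polynomial.leadingCoeff_eq_zero.mp hcoeff)
  omega

end Infinite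

end Valuation

section Factors

variable {k : Type*} [Field k] {n : ℕ} {β : k} {v : Place k (RatFunc k)}

instance charP_resField [CharP k 3] : CharP v.ResField 3 :=
  charP_of_injective_algebraMap (algebraMap k v.ResField).injective 3

/-- The reduction is singular with `b₂ = 0`, so `Δ = -8b₄³ = 0` in characteristic three gives `b₄ =
0`. The cubic is then cuspidal and its trace is zero. -/
theorem localFactor_eq_one [Finite k] [CharP k 3] (hn : 1 ≤ n) (hβ : β ≠ 0)
    (hv : RatFunc.X ∉ v.ring) : localFactor (curveE k n β) v = 1 := by
  have : Finite v.ResField := .of_surjective _ (Place.algebraMap_resField_surjective hv)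
  obtain ⟨C, hC⟩ := exists_minimal_eq v.ring (curveE k n β)
  have hbad : ¬ ((curveE k n β).minimal v.ring).HasGoodReduction v.ring := fun hgood => by
    refine Place.cubic_add_X_pow_notMem hv β ?_ C.r
      (integral_of_hasGoodReduction n v hβ hC hgood).2.2.2.2
    intro h
    have := (Nat.dvd_add_right (dvd_pow_self 3 (by omega : n ≠ 0))).mp h
    omega
  rw [localFactor, if_neg hbad]
  rw [hasGoodReduction_iff_isElliptic_reduction, isElliptic_iff, isUnit_iff_ne_zero, not_not]
    at hbad
  have h3 : (3 : v.ResField) = 0 := by exact_mod_cast CharP.cast_eq_zero v.ResField 3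
  have hb2 : (((curveE k n β).minimal v.ring).reduction v.ring).b₂ = 0 := by
    have h0 : (((curveE k n β).minimal v.ring).integralModel v.ring).b₂ = 0 := by
      apply FaithfulSMul.algebraMap_injective v.ring (RatFunc k)
      rw [integralModel_b₂_eq, hC, variableChange_curveE_b₂, map_zero]
    rw [reduction, map_b₂, h0, map_zero]
  have hb4 : (((curveE k n β).minimal v.ring).reduction v.ring).b₄ = 0 := by
    rw [WeierstrassCurve.Δ, hb2] at hbad
    refine pow_eq_zero_iff (n := 3) (by norm_num) |>.mp ?_
    generalize (((curveE k n β).minimal v.ring).reduction v.ring) = W at *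
    linear_combination hbad + (3 * W.b₄ ^ 3 + 9 * W.b₆ ^ 2) * h3
  have : traceAt (curveE k n β) v = 0 := by
    rw [traceAt, numPoints_of_b_eq_zero _ hb2 hb4]
    push_cast
    ring
  simp [this]

variable (hv : RatFunc.X ∈ v.ring)

/-- The short Weierstrass model of `E` over the valuation ring. -/
noncomputable def integralCurveE (n : ℕ) (β : k) : WeierstrassCurve v.ring where
  a₁ := 0
  a₂ := 0
  a₃ := 0
  a₄ := algebraMap k v.ring β
  a₆ := ⟨RatFunc.X, hv⟩ ^ (3 ^ n + 1)

theorem integralCurveE_map :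
    (integralCurveE hv n β).map (algebraMap v.ring (RatFunc k)) = curveE k n β := by
  ext
  · simp [integralCurveE, curveE]
  · simp [integralCurveE, curveE]
  · simp [integralCurveE, curveE]
  · rfl
  · rfl

section Good

variable [CharP k 3] (hβ : β ≠ 0)
include hv hβ

theorem hasGoodReduction_curveE :
    ((curveE k n β).minimal v.ring).HasGoodReduction v.ring := by
  have : (curveE k n β).IsIntegral v.ring := ⟨_, (integralCurveE_map hv).symm⟩
  refine hasGoodReduction_minimal v.ring _ (u := algebraMap k v.ring (-β ^ 3)) ?_ ?_
  · exact (IsUnit.mk0 _ (by simpa using hβ)).map _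
  · rw [curveE_Δ]
    rfl

/-- The change of variables between the short model and the minimal one is defined over the
valuation ring, hence reduces to one over the residue field. -/
theorem numPoints_reduction :
    numPoints (((curveE k n β).minimal v.ring).reduction v.ring) =
      Nat.card {P : v.ResField × v.ResField // P.2 ^ 2 = P.1 ^ 3 + algebraMap k v.ResField β * P.1 +
        Place.residueX hv ^ (3 ^ n + 1)} + 1 := by
  obtain ⟨C, hC⟩ := exists_minimal_eq v.ring (curveE k n β)
  obtain ⟨hu, hui, hs, ht, hr⟩ :=
    integral_of_hasGoodReduction n v hβ hC (hasGoodReduction_curveE hv hβ)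
  replace hr : C.r ∈ v.ring := by
    refine v.mem_of_cubic_mem β ?_
    simpa using sub_mem hr (pow_mem hv (3 ^ n + 1))
  let C' : VariableChange v.ring :=
    ⟨⟨⟨_, hu⟩, ⟨_, hui⟩, Subtype.ext C.u.mul_inv, Subtype.ext C.u.inv_mul⟩,
      ⟨_, hr⟩, ⟨_, hs⟩, ⟨_, ht⟩⟩
  have hC' : C'.map (algebraMap v.ring (RatFunc k)) = C := by
    ext <;> rfl
  have hmodel : ((curveE k n β).minimal v.ring).integralModel v.ring =
      C' • integralCurveE hv n β := by
    apply map_injective (FaithfulSMul.algebraMap_injective v.ring (RatFunc k))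
    beta_reduce
    rw [← map_variableChange, hC', integralCurveE_map, ← hC]
    exact baseChange_integralModel_eq _ _
  rw [reduction, hmodel, ← map_variableChange, numPoints_variableChange, numPoints]
  congr 1
  refine Nat.card_congr (Equiv.subtypeEquivRight fun P => ?_)
  rw [Affine.equation_iff]
  simp only [integralCurveE, map_a₁, map_a₂, map_a₃, map_a₄, map_a₆, map_zero, zero_mul, add_zero, map_pow]
  rfl

end Good

open scoped Classical in
theorem AdmissibleCoeff.traceAt_eq [CharP k 3] (h : AdmissibleCoeff n β) :
    traceAt (curveE k n β) v = (-3 ^ n) ^ v.degree *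
      if Place.residueX hv ^ (3 ^ n + 1) ∈ cubicImage (algebraMap k v.ResField β)
        then 2 else -1 := by
  have := h.finite
  have := Place.finite_resField hv
  have : Finite v.ResField := Module.finite_of_finite k
  have := Fintype.ofFinite v.ResField
  rw [traceAt, numPoints_reduction hv h.ne_zero, Nat.card_eq_fintype_card,
    Nat.card_eq_fintype_card, Fintype.card_subtype]
  push_cast
  rw [h.card_cubic_points v.ResField rfl]
  simp only [Place.degree]
  ring

open scoped Classical in
theorem AdmissibleCoeff.localFactor_eq [CharP k 3] (h : AdmissibleCoeff n β) :
    (localFactor (curveE k n β) v : PowerSeries ℤ) =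
      1 - PowerSeries.C ((-3 ^ n) ^ v.degree *
        if Place.residueX hv ^ (3 ^ n + 1) ∈ cubicImage (algebraMap k v.ResField β)
          then 2 else -1) * PowerSeries.X ^ v.degree +
        PowerSeries.C (((-3 ^ n) ^ v.degree) ^ 2) * PowerSeries.X ^ (2 * v.degree) := by
  rw [localFactor, if_pos (hasGoodReduction_curveE hv h.ne_zero), h.traceAt_eq hv, h.card_eq]
  have hq : (((3 ^ n) ^ 2 : ℕ) : ℤ) ^ v.degree = ((-3 ^ n) ^ v.degree) ^ 2 := by
    push_cast
    rw [← pow_mul (-3 ^ n : ℤ), mul_comm v.degree, pow_mul, neg_sq]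
  rw [hq, Polynomial.coe_add, Polynomial.coe_sub, Polynomial.coe_mul, Polynomial.coe_mul,
    Polynomial.coe_one, Polynomial.coe_pow, Polynomial.coe_pow, Polynomial.coe_C,
    Polynomial.coe_C, Polynomial.coe_X]

theorem AdmissibleCoeff.eulerFactor_eq_one [CharP k 3] (h : AdmissibleCoeff n β) (hv : RatFunc.X ∉ v.ring) :
    eulerFactor (curveE k n β) v = 1 := by
  have := h.finite
  have hmul := PowerSeries.mul_invOfUnit
    ((localFactor (curveE k n β) v : PowerSeries ℤ)) 1
    (by rw [localFactor_eq_one h.one_le h.ne_zero hv]; simp)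
  rw [eulerFactor, localFactor_eq_one h.one_le h.ne_zero hv, Polynomial.coe_one]
  rwa [localFactor_eq_one h.one_le h.ne_zero hv, Polynomial.coe_one, one_mul] at hmul

open scoped Classical in
theorem AdmissibleCoeff.exists_isLogDeriv_eulerFactor [CharP k 3] (h : AdmissibleCoeff n β)
    (hv : RatFunc.X ∈ v.ring) :
    ∃ g, IsLogDeriv (eulerFactor (curveE k n β) v) g ∧ ∀ j ≠ 0, PowerSeries.coeff j g =
      if v.degree ∣ j then v.degree * ((-3 ^ n : ℤ) ^ j *
        if Place.residueX hv ^ (3 ^ n + 1) ∈ cubicImage (algebraMap k v.ResField β) ∨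
          3 ∣ j / v.degree then 2 else -1) else 0 := by
  refine exists_isLogDeriv_of_mul_eq_one (Place.degree_ne_zero hv) _ _ ?_
  rw [← h.localFactor_eq hv]
  refine PowerSeries.mul_invOfUnit _ _ ?_
  have hd := Place.degree_ne_zero hv
  rw [h.localFactor_eq hv]
  have key : ∀ a b : ℤ, PowerSeries.constantCoeff (1 - PowerSeries.C a * PowerSeries.X ^ v.degree +
      PowerSeries.C b * PowerSeries.X ^ (2 * v.degree)) = 1 := fun a b => by simp [hd]
  exact key _ _

end Factors

end FunctionField

/-! ### Regrouping traces by place, and convergence of the Euler product. -/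

namespace FunctionField

namespace Place

variable {k : Type*} [Field k] {L : Type*} [Field L] [Algebra k L] [Algebra.IsIntegral k L]

/-- The place of `k(t)` at which `t` reduces to a conjugate of `θ`. -/
noncomputable def ofIntegral (k : Type*) [Field k] {L : Type*} [Field L] [Algebra k L]
    [Algebra.IsIntegral k L] (θ : L) : Place k (RatFunc k) :=
  (exists_algHom_residueX_eq (Algebra.IsIntegral.isIntegral (R := k) θ)).choose

theorem X_mem_ofIntegral (θ : L) : RatFunc.X ∈ (ofIntegral k θ).ring :=
  (exists_algHom_residueX_eq (Algebra.IsIntegral.isIntegral (R := k) θ)).choose_spec.choose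

theorem exists_algHom_ofIntegral (θ : L) :
    ∃ φ : (ofIntegral k θ).ResField →ₐ[k] L, φ (residueX (X_mem_ofIntegral θ)) = θ :=
  (exists_algHom_residueX_eq
    (Algebra.IsIntegral.isIntegral (R := k) θ)).choose_spec.choose_spec

variable {v : Place k (RatFunc k)} (hv : RatFunc.X ∈ v.ring)

theorem ofIntegral_eq_iff (θ : L) :
    ofIntegral k θ = v ↔ ∃ φ : v.ResField →ₐ[k] L, φ (residueX hv) = θ := by
  constructor
  · rintro rfl
    exact exists_algHom_ofIntegral θ
  · rintro ⟨φ, hφ⟩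
    obtain ⟨ψ, hψ⟩ := exists_algHom_ofIntegral (k := k) θ
    exact eq_of_algHom (X_mem_ofIntegral θ) hv (hψ.trans hφ.symm)

include hv in
/-- The elements of `L` lying over `v` are the embeddings of the residue field. -/
theorem card_ofIntegral_eq :
    Nat.card {θ : L // ofIntegral k θ = v} = Nat.card (v.ResField →ₐ[k] L) := by
  refine (Nat.card_congr (Equiv.ofBijective
    (fun φ => ⟨φ (residueX hv), (ofIntegral_eq_iff hv _).mpr ⟨φ, rfl⟩⟩) ⟨?_, ?_⟩)).symm
  · intro φ ψ h
    exact algHom_ext hv (congrArg Subtype.val h)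
  · rintro ⟨θ, hθ⟩
    obtain ⟨φ, hφ⟩ := (ofIntegral_eq_iff hv θ).mp hθ
    exact ⟨φ, Subtype.ext hφ⟩

theorem degree_ofIntegral_dvd [Finite k] (θ : L) [Finite L] :
    (ofIntegral k θ).degree ∣ Module.finrank k L := by
  have := finite_resField (X_mem_ofIntegral (k := k) θ)
  have : Finite (ofIntegral k θ).ResField := Module.finite_of_finite k
  obtain ⟨φ, -⟩ := exists_algHom_ofIntegral (k := k) θ
  exact FiniteField.nonempty_algHom_iff_finrank_dvd.mp ⟨φ⟩

/-- Each such residue field embeds in the extension of degree `d`, so each such place lies under one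
of its finitely many elements. -/
theorem finite_setOf_degree_eq (k : Type*) [Field k] [Finite k] [CharP k 3] (d : ℕ) :
    {v : Place k (RatFunc k) | RatFunc.X ∈ v.ring ∧ v.degree = d}.Finite := by
  rcases eq_or_ne d 0 with rfl | hd
  · convert! Set.finite_empty
    ext v
    simpa using fun hv => degree_ne_zero hv
  have : Fact (Nat.Prime 3) := ⟨Nat.prime_three⟩
  have : NeZero d := ⟨hd⟩
  refine (Set.finite_range (ofIntegral k (L := FiniteField.Extension k 3 d))).subset ?_
  rintro v ⟨hv, hvd⟩
  have := finite_resField hv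
  have : Finite v.ResField := Module.finite_of_finite k
  have hne : Nonempty (v.ResField →ₐ[k] FiniteField.Extension k 3 d) := by
    rw [FiniteField.nonempty_algHom_iff_finrank_dvd, FiniteField.finrank_extension]
    exact hvd.dvd
  exact ⟨_, (ofIntegral_eq_iff hv _).mpr ⟨hne.some, rfl⟩⟩

theorem finite_setOf_degree_le (k : Type*) [Field k] [Finite k] [CharP k 3] (N : ℕ) :
    {v : Place k (RatFunc k) | RatFunc.X ∈ v.ring ∧ v.degree ≤ N}.Finite := by
  refine ((Set.finite_Iic N).biUnion fun d _ => finite_setOf_degree_eq k d).subset ?_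
  rintro v ⟨hv, hd⟩
  exact Set.mem_biUnion (x := v.degree) hd ⟨hv, rfl⟩

end Place

section EulerProduct

variable {k : Type*} [Field k] [CharP k 3] {n : ℕ} {β : k} (h : AdmissibleCoeff n β)
include h

open Finset

open scoped Classical in
/-- The contribution of the elements of `L` lying over `v` to the sum of traces. -/
theorem AdmissibleCoeff.sum_filter_ofIntegral {v : Place k (RatFunc k)} (hv : RatFunc.X ∈ v.ring)
    (L : Type*) [Field L] [Algebra k L] [CharP L 3] [Fintype L] [Algebra.IsIntegral k L] {m : ℕ}
    (hm : Module.finrank k L = m) :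
    ∑ θ : L with Place.ofIntegral k θ = v, ((-3 ^ n : ℤ) ^ m *
        if θ ^ (3 ^ n + 1) ∈ cubicImage (algebraMap k L β) then 2 else -1 : ℤ) =
      if v.degree ∣ m then v.degree * ((-3 ^ n : ℤ) ^ m *
        if Place.residueX hv ^ (3 ^ n + 1) ∈ cubicImage (algebraMap k v.ResField β) ∨
          3 ∣ m / v.degree then 2 else -1) else 0 := by
  subst hm
  have := h.finite
  have := Place.finite_resField hv
  have : Finite v.ResField := Module.finite_of_finite k
  by_cases hd : v.degree ∣ Module.finrank k L
  · rw [if_pos hd, Finset.sum_congr rfl (g := fun _ => (-3 ^ n : ℤ) ^ Module.finrank k L *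
      if Place.residueX hv ^ (3 ^ n + 1) ∈ cubicImage (algebraMap k v.ResField β) ∨
        3 ∣ Module.finrank k L / v.degree then 2 else -1), Finset.sum_const, nsmul_eq_mul,
      ← Fintype.card_subtype, ← Nat.card_eq_fintype_card, Place.card_ofIntegral_eq hv,
      FiniteField.natCard_algHom_of_finrank_dvd hd]
    · rfl
    intro θ hθ
    obtain ⟨φ, rfl⟩ := (Place.ofIntegral_eq_iff hv θ).mp (Finset.mem_filter.mp hθ).2
    -- Viewing `L` as an extension of the residue field of degree `m / deg v` makes
    -- `algebraMap_mem_range_iff` applicable.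
    let _ : Algebra v.ResField L := φ.toRingHom.toAlgebra
    have : IsScalarTower k v.ResField L := .of_algebraMap_eq fun c => (φ.commutes c).symm
    have hr := Module.finrank_mul_finrank k v.ResField L
    have hdiv : Module.finrank k L / v.degree = Module.finrank v.ResField L := by
      rw [← hr]
      exact Nat.mul_div_cancel_left _ (Nat.pos_of_ne_zero (Place.degree_ne_zero hv))
    rw [hdiv, ← map_pow]
    congr 1
    exact if_congr (h.algebraMap_mem_range_iff v.ResField L _) rfl rfl
  · rw [if_neg hd]
    refine Finset.sum_eq_zero fun θ hθ => absurd ?_ hd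
    rw [← (Finset.mem_filter.mp hθ).2]
    exact Place.degree_ofIntegral_dvd θ

/-- One series `g` serves all `L` at once. At the infinite place it is zero, matching the empty set
of elements over that place. -/
theorem AdmissibleCoeff.exists_isLogDeriv_sum_filter (v : Place k (RatFunc k)) :
    ∃ g, IsLogDeriv (eulerFactor (curveE k n β) v) g ∧ ∀ (L : Type) [Field L] [Algebra k L]
      [CharP L 3] [Fintype L] [Algebra.IsIntegral k L], PowerSeries.coeff (Module.finrank k L) g =
        open scoped Classical in ∑ θ : L with Place.ofIntegral k θ = v, ((-3 ^ n : ℤ) ^ Module.finrank k L *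
        if θ ^ (3 ^ n + 1) ∈ cubicImage (algebraMap k L β) then 2 else -1 : ℤ) := by
  classical
  by_cases hv : RatFunc.X ∈ v.ring
  · obtain ⟨g, hg, hcoeff⟩ := h.exists_isLogDeriv_eulerFactor hv
    refine ⟨g, hg, fun L _ _ _ _ _ => ?_⟩
    have := h.finite
    have : Module.Finite k L := .of_finite
    rw [hcoeff _ Module.finrank_pos.ne']
    exact (h.sum_filter_ofIntegral hv L rfl).symm
  · rw [h.eulerFactor_eq_one hv]
    refine ⟨0, .one, fun L _ _ _ _ _ => ?_⟩
    rw [map_zero]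
    refine (Finset.sum_eq_zero fun θ hθ => absurd ?_ hv).symm
    rw [← (Finset.mem_filter.mp hθ).2]
    exact Place.X_mem_ofIntegral θ

omit h [CharP k 3] in
theorem constantCoeff_eulerFactor (E : WeierstrassCurve (RatFunc k)) (v : Place k (RatFunc k)) :
    PowerSeries.constantCoeff (eulerFactor E v) = 1 := by
  rw [eulerFactor, PowerSeries.constantCoeff_invOfUnit]
  rfl

/-- Partial Euler products agree with the `L`-function up to the degree of the omitted places. -/
theorem AdmissibleCoeff.coeff_prod_eulerFactor {N : ℕ} {s : Finset (Place k (RatFunc k))}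
    (hs : ∀ v : Place k (RatFunc k), RatFunc.X ∈ v.ring → v.degree ≤ N → v ∈ s) :
    PowerSeries.coeff N (∏ v ∈ s, eulerFactor (curveE k n β) v) =
      PowerSeries.coeff N ((1 - PowerSeries.C (((3 : ℤ) ^ n) ^ 2) * PowerSeries.X) ^ (2 * 3 ^ n)) := by
  classical
  choose g hg hcoeff using h.exists_isLogDeriv_sum_filter
  obtain ⟨g', hg', hcoeff'⟩ := isLogDeriv_one_sub_pow (((3 : ℤ) ^ n) ^ 2) (2 * 3 ^ n)
  refine (IsLogDeriv.prod s fun v _ => hg v).coeff_eq hg' ?_ ?_ N fun j hj hjN => ?_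
  · rw [map_prod]
    exact Finset.prod_eq_one fun v _ => constantCoeff_eulerFactor _ v
  · simp
  rw [hcoeff' j hj, map_sum]
  have := h.finite
  have : Fact (Nat.Prime 3) := ⟨Nat.prime_three⟩
  have : NeZero j := ⟨hj⟩
  -- The coefficient of index `j` is read off on the extension of degree `j`. Its elements lie over
  -- places of degree dividing `j ≤ N`, all of them in `s`, so the sum over `s` is the full sum of
  -- `sum_trace`.
  let L := FiniteField.Extension k 3 j
  have hL : Module.finrank k L = j := FiniteField.finrank_extension k 3 j
  have : CharP L 3 := charP_of_injective_algebraMap (algebraMap k L).injective 3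
  have := Fintype.ofFinite L
  have hsum := h.sum_trace L hL
  have hmaps : ∀ θ ∈ (Finset.univ : Finset L), Place.ofIntegral k θ ∈ s := fun θ _ => by
    refine hs _ (Place.X_mem_ofIntegral θ) (le_trans (Nat.le_of_dvd (Nat.pos_of_ne_zero hj) ?_) hjN)
    exact (Place.degree_ofIntegral_dvd θ).trans hL.dvd
  rw [← Finset.sum_fiberwise_of_maps_to hmaps] at hsum
  have heq : ∀ v, PowerSeries.coeff j (g v) = ∑ θ : L with Place.ofIntegral k θ = v,
      ((-3 ^ n : ℤ) ^ j * if θ ^ (3 ^ n + 1) ∈ cubicImage (algebraMap k L β) then 2 else -1 : ℤ) :=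
    fun v => by
      have := hcoeff v L
      rwa [hL] at this
  rw [Finset.sum_congr rfl fun v _ => heq v, hsum]
  push_cast
  ring

/-- Each coefficient is constant once the finite set contains all places of degree at most `N` where
`t` is integral. -/
theorem AdmissibleCoeff.hasProd_eulerFactor :
    HasProd (fun v : Place k (RatFunc k) => eulerFactor (curveE k n β) v)
      ((1 - PowerSeries.C (((3 : ℤ) ^ n) ^ 2) * PowerSeries.X) ^ (2 * 3 ^ n)) := by
  have := h.finite
  rw [HasProd, PowerSeries.WithPiTopology.tendsto_iff_coeff_tendsto]
  intro N
  refine tendsto_const_nhds.congr' ?_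
  filter_upwards [Filter.eventually_ge_atTop (Place.finite_setOf_degree_le k N).toFinset] with s hs
  refine (h.coeff_prod_eulerFactor fun v hv hd => hs ?_).symm
  simpa using ⟨hv, hd⟩

end EulerProduct

/-! ### Analytic rank and the main theorem. -/

section AnalyticRank

/-- A curve whose `L`-function is `(1 - |k| T) ^ r` has analytic rank `r`. -/
theorem hasAnalyticRank_of_eq_pow {k K : Type*} [Field k] [Finite k] [Field K] [Algebra k K]
    (E : WeierstrassCurve K) (r : ℕ)
    (hL : LFunction k E = (1 - PowerSeries.C (Nat.card k : ℤ) * PowerSeries.X) ^ r) :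
    HasAnalyticRank k E r := by
  have hq : (Nat.card k : ℚ) ≠ 0 := by exact_mod_cast Nat.card_pos.ne'
  have hmap : ((1 - Polynomial.C (Nat.card k : ℤ) * Polynomial.X) ^ r).map (Int.castRingHom ℚ) =
      Polynomial.C ((-(Nat.card k : ℚ)) ^ r) * (Polynomial.X - Polynomial.C (Nat.card k : ℚ)⁻¹) ^ r := by
    rw [Polynomial.map_pow, Polynomial.C_pow, ← mul_pow]
    congr 1
    rw [mul_sub, ← Polynomial.C_mul, neg_mul, mul_inv_cancel₀ hq]
    simp
    ring
  refine ⟨(1 - Polynomial.C (Nat.card k : ℤ) * Polynomial.X) ^ r, fun h0 => ?_, ?_, ?_⟩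
  · rw [h0, Polynomial.map_zero, eq_comm] at hmap
    refine mul_ne_zero ?_ (pow_ne_zero r (Polynomial.X_sub_C_ne_zero _)) hmap
    exact Polynomial.C_ne_zero.mpr (pow_ne_zero r (neg_ne_zero.mpr hq))
  · rw [hL, Polynomial.coe_pow, Polynomial.coe_sub, Polynomial.coe_mul, Polynomial.coe_one,
      Polynomial.coe_C, Polynomial.coe_X]
  · rw [hmap, Polynomial.rootMultiplicity_mul_X_sub_C_pow
      (Polynomial.C_ne_zero.mpr (pow_ne_zero r (neg_ne_zero.mpr hq))), Polynomial.rootMultiplicity_C,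
      zero_add]

end AnalyticRank

theorem AdmissibleCoeff.of_card_eq_sq {n : ℕ} (hn : 1 ≤ n) {F k : Type*} [Field F] [Finite F]
    [Field k] [Finite k] [Algebra F k] (hF : Nat.card F = 3 ^ n) (hk : Nat.card k = (3 ^ n) ^ 2)
    (b : Fˣ) (hb : b ^ ((3 ^ n - 1) / 2) = (-1) ^ (n + 1)) :
    AdmissibleCoeff n (algebraMap F k b) where
  one_le := hn
  card_eq := hk
  ne_zero := by simp
  pow_half := by
    rw [← map_pow, ← Units.val_pow_eq_pow_val, hb]
    simp
  le_card_fixed := by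
    have := Fintype.ofFinite F
    rw [← hF]
    refine Nat.card_le_card_of_injective
      (fun x => ⟨algebraMap F k x, ?_⟩) fun x y hxy => ?_
    · rw [← map_pow, hF, ← hF, Nat.card_eq_fintype_card, FiniteField.pow_card]
    · exact (algebraMap F k).injective (congrArg Subtype.val hxy)

end FunctionField

theorem theoremA (n q : ℕ) (hn : 1 ≤ n) (hq : q = 3 ^ n)
    {F k : Type*} [Field F] [Finite F] [Field k] [Finite k] [Algebra F k]
    (hF : Nat.card F = q) (hk : Nat.card k = q ^ 2)
    (b : Fˣ) (hb : b ^ ((q - 1) / 2) = (-1) ^ (n + 1)) :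
    (FunctionField.curveE k n (algebraMap F k b)).IsElliptic ∧
    Multipliable (fun v : FunctionField.Place k (RatFunc k) =>
      FunctionField.eulerFactor (FunctionField.curveE k n (algebraMap F k b)) v) ∧
    FunctionField.LFunction k (FunctionField.curveE k n (algebraMap F k b)) =
      (1 - PowerSeries.C ((q : ℤ) ^ 2) * PowerSeries.X) ^ (2 * 3 ^ n) ∧
    FunctionField.HasAnalyticRank k (FunctionField.curveE k n (algebraMap F k b)) (2 * 3 ^ n) := by
  subst hq
  have h := FunctionField.AdmissibleCoeff.of_card_eq_sq hn hF hk b hb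
  have := h.charP
  have hprod := h.hasProd_eulerFactor
  have hL : FunctionField.LFunction k (FunctionField.curveE k n (algebraMap F k b)) =
      (1 - PowerSeries.C (((3 ^ n : ℕ) : ℤ) ^ 2) * PowerSeries.X) ^ (2 * 3 ^ n) := by
    push_cast
    exact hprod.tprod_eq
  refine ⟨?_, hprod.multipliable, hL, ?_⟩
  · rw [WeierstrassCurve.isElliptic_iff, FunctionField.curveE_Δ, isUnit_iff_ne_zero]
    simp
  · refine FunctionField.hasAnalyticRank_of_eq_pow _ _ ?_
    rw [hL, hk]
    push_cast
    rfl
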